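/- For measurable functions on $\mathbb{R}^3$ write $\langle v\rangle=\sqrt{1+|v|^2}$, $\|f\|_{L^p_l}=\bigl(\int_{\mathbb{R}^3}|f(v)|^p\langle v\rangle^{lp}\,dv\bigr)^{1/p}$, let $L^p_l$ be the space of measurable $f:\mathbb{R}^3\to\mathbb{R}$ with $\|f\|_{L^p_l}<\infty$, and put $\langle f,g\rangle=\int_{\mathbb{R}^3}f(v)g(v)\,dv$. For $\gamma\in[0,1]$ let $$Q(f,g)(v)=\int_{\mathbb{R}^3}\int_{\mathbb{S}^2}|v-v_*|^\gamma\bigl[f(v_*')g(v')-f(v_*)g(v)\bigr]\,d\sigma\,dv_*,\qquad v'=\tfrac{v+v_*}{2}+\tfrac{|v-v_*|}{2}\sigma,\quad v_*'=\tfrac{v+v_*}{2}-\tfrac{|v-v_*|}{2}\sigma,$$ where $d\sigma$ is the surface measure on the unit sphere $\mathbb{S}^2$. **Theorem.** There are absolute constants $C_1,C_2>0$ and, for each real $k$, a constant $C_k>0$ depending only on $k$, such that for all real $\gamma,k$ with $0\le\gamma\le1$ and $k\ge8$ the following holds. (1) For all $f,g,h\in L^2_{k+\gamma/2}$, the integral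 defining $Q(f,g)(v)$ converges absolutely for almost every $v$, the function $Q(f,g)\,h\,\langle v\rangle^{2k}$ is integrable, and $$\bigl\langle Q(f,g),h\langle v\rangle^{2k}\bigr\rangle\le\frac{C_1}{\sqrt k}\|g\|_{L^1_\gamma}\|f\|_{L^2_{k+\gamma/2}}\|h\|_{L^2_{k+\gamma/2}}+C_2\|f\|_{L^1_\gamma}\|g\|_{L^2_{k+\gamma/2}}\|h\|_{L^2_{k+\gamma/2}}+C_k\|f\|_{L^2_k}\|g\|_{L^2_k}\|h\|_{L^2_k}.$$ (2) For all $f,g\in L^2_{k+\gamma}$, $Q(f,g)\in L^2_k$ and $$\|Q(f,g)\|_{L^2_k}\le\frac{C_1}{\sqrt k}\|g\|_{L^1_\gamma}\|f\|_{L^2_{k+\gamma}}+C_2\|f\|_{L^1_\gamma}\|g\|_{L^2_{k+\gamma}}+C_k\|f\|_{L^2_k}\|g\|_{L^2_k}.$$ -/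

import Mathlib

open MeasureTheory

noncomputable section

namespace Boltzmann

/-- The velocity space `ℝ³` with its Euclidean norm. -/
abbrev V : Type := EuclideanSpace ℝ (Fin 3)

/-- The unit sphere `𝕊²` of the velocity space. -/
abbrev S2 : Type := Metric.sphere (0 : V) 1

/-- The surface measure `dσ` on `𝕊²` (of total mass `4π`). -/
abbrev sphereMeasure : Measure S2 := (volume : Measure V).toSphere

/-- The post-collisional velocity `v' = (v + v_*)/2 + (|v - v_*|/2) σ`. -/
def vPrime (v vs : V) (σ : S2) : V :=
  (1 / 2 : ℝ) • (v + vs) + (‖v - vs‖ / 2) • (σ : V)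

/-- The post-collisional velocity `v'_* = (v + v_*)/2 - (|v - v_*|/2) σ`. -/
def vsPrime (v vs : V) (σ : S2) : V :=
  (1 / 2 : ℝ) • (v + vs) - (‖v - vs‖ / 2) • (σ : V)

/-- The integrand `|v - v_*|^γ (f(v'_*) g(v') - f(v_*) g(v))` of the collision operator, for the
kernel `B(|v - v_*|, cos θ) = |v - v_*|^γ`. -/
def collisionIntegrand (γ : ℝ) (f g : V → ℝ) (v vs : V) (σ : S2) : ℝ :=
  ‖v - vs‖ ^ γ * (f (vsPrime v vs σ) * g (vPrime v vs σ) - f vs * g v)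

/-- The Boltzmann collision operator
`Q(f,g)(v) = ∫_{ℝ³} ∫_{𝕊²} |v - v_*|^γ (f(v'_*) g(v') - f(v_*) g(v)) dσ dv_*`. -/
def Q (γ : ℝ) (f g : V → ℝ) (v : V) : ℝ :=
  ∫ vs : V, ∫ σ : S2, collisionIntegrand γ f g v vs σ ∂sphereMeasure

/-- The Japanese bracket `⟨v⟩ = √(1 + |v|²)`. -/
def jap (v : V) : ℝ := Real.sqrt (1 + ‖v‖ ^ 2)

/-- Membership in the weighted space `L^p_l`: `f` is a.e. strongly measurable and
`∫ |f(v)|^p ⟨v⟩^{lp} dv < ∞`, that is, `⟨·⟩^l f ∈ L^p`. -/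
def MemWLp (p : ENNReal) (l : ℝ) (f : V → ℝ) : Prop :=
  MemLp (fun v => jap v ^ l * f v) p volume

/-- The weighted norm `‖f‖_{L^p_l} = (∫ |f(v)|^p ⟨v⟩^{lp} dv)^{1/p}`, that is, the `L^p` norm of
`⟨·⟩^l f`. -/
def wNorm (p : ENNReal) (l : ℝ) (f : V → ℝ) : ℝ :=
  (eLpNorm (fun v => jap v ^ l * f v) p volume).toReal

/-- The pairing `⟨f, g⟩ = ∫_{ℝ³} f(v) g(v) dv`. -/
def pairing (f g : V → ℝ) : ℝ := ∫ v : V, f v * g v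

end Boltzmann

end

/-!
The operator is estimated through absolute values, so the gain and loss parts may be treated
separately for nonnegative functions with values in `[0, ∞]`. The loss part is elementary:
`|v - v_*|^γ ≤ 2 ⟨v⟩^γ ⟨v_*⟩^γ`, and its constant does not decay in `k`.

For the gain part, the collisional change of variables (`lintegral_collision_swap`) moves the weight
to `⟨v'⟩^k`. Let `s = |v' - v_*| / |v - v_*|` and `c = |v' - v| / |v - v_*|`, the cosine and sine of
half the deflection angle (`halfCos`). Ptolemy's inequality in `ℝ³ × ℝ` gives
`⟨v'⟩ ≤ s ⟨v⟩ + c ⟨v_*⟩` (`jap_vPrime_le`), so that up to cross terms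
`⟨v'⟩^k ≤ s^k ⟨v⟩^k + c^k ⟨v_*⟩^k`. The cross terms have a `k`-dependent coefficient, but no velocity
carries more than the weight `⟨·⟩^k` in them, even after multiplication by `|v - v_*|^γ`; they make up
the term with `C_k`.

In the principal terms the smallness comes from the angular factor `s^k`
(`exists_bilinear_deflect_bound`). By Cauchy–Schwarz, the integral of `G(v) H(v') s^p` over `v` and
`σ` is bounded by the square root of a product of two integrals. In the first, `∫ s^p dσ = O(1/p)`
because `s^p` is dominated by a Gaussian of variance of order `1/p` on the sphere
(`lintegral_sphere_halfCos_rpow_le`). In the second, the change of variables `v ↦ v'` at fixed `v_*`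
and `σ` has Jacobian `s² / 4`, which `s^p` compensates (`lintegral_comp_deflect_le`). This produces
the factor `1/√k`. The kernel being independent of the angle, the same bound holds with the roles of
`v` and `v_*` exchanged.

Finally `|v - v_*|^γ s^k` is distributed among the velocities by means of `|v - v_*| s = |v' - v_*|`
(`rpow_mul_rpow_le`): half of the weight goes to `h` for the pairing, and none for the norm estimate,
which then follows by duality (`l2_le_of_forall_lintegral_mul_le`). Functions that are only almost
everywhere measurable are replaced by measurable representatives; this does not change `Q` almost
everywhere, since null sets are respected by the collisional change of variables.
-/

noncomputable section

namespace Boltzmann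

open scoped ENNReal

/-! ### Polar coordinates and the collisional change of variables -/

theorem lintegral_eq_lintegral_sphere (φ : V → ℝ≥0∞) (hφ : Measurable φ) :
    ∫⁻ u, φ u = ∫⁻ ω : S2, ∫⁻ r : Set.Ioi (0 : ℝ), φ ((r : ℝ) • (ω : V))
      ∂(Measure.volumeIoiPow 2) ∂sphereMeasure := by
  have h := (volume : Measure V).measurePreserving_homeomorphUnitSphereProd
  have hd : Module.finrank ℝ V - 1 = 2 := by simp
  rw [hd] at h
  have hm : Measurable fun p : S2 × Set.Ioi (0 : ℝ) => φ ((p.2 : ℝ) • (p.1 : V)) := by fun_prop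
  rw [← lintegral_prod (fun p : S2 × Set.Ioi (0 : ℝ) => φ ((p.2 : ℝ) • (p.1 : V))) hm.aemeasurable,
    ← h.lintegral_comp hm]
  calc ∫⁻ u, φ u = ∫⁻ u in ({0}ᶜ : Set V), φ u := by
        rw [restrict_compl_singleton]
    _ = ∫⁻ u : ({0}ᶜ : Set V), φ u ∂((volume : Measure V).comap Subtype.val) := by
        rw [lintegral_subtype_comap (measurableSet_singleton _).compl]
    _ = _ := by
        refine lintegral_congr fun u => ?_
        have hu : ‖(u : V)‖ ≠ 0 := norm_ne_zero_iff.2 u.2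
        simp [smul_smul, hu]

section Measurability

variable {α : Type*} [MeasurableSpace α] {f g : α → V} {τ : α → S2}

@[fun_prop]
theorem measurable_vPrime (hf : Measurable f) (hg : Measurable g) (hτ : Measurable τ) :
    Measurable fun a => vPrime (f a) (g a) (τ a) := by
  unfold vPrime; fun_prop

@[fun_prop]
theorem measurable_vsPrime (hf : Measurable f) (hg : Measurable g) (hτ : Measurable τ) :
    Measurable fun a => vsPrime (f a) (g a) (τ a) := by
  unfold vsPrime; fun_prop

end Measurability

theorem lintegral_lintegral_center_relative (φ : V → V → ℝ≥0∞)
    (hφ : Measurable (Function.uncurry φ)) :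
    ∫⁻ v, ∫⁻ vs, φ v vs = ∫⁻ z : V, ∫⁻ u : V, φ (z + (1 / 2 : ℝ) • u) (z - (1 / 2 : ℝ) • u) := by
  calc ∫⁻ v, ∫⁻ vs, φ v vs = ∫⁻ v : V, ∫⁻ u : V, φ v (v - u) := by
        refine lintegral_congr fun v => ?_
        exact (lintegral_sub_left_eq_self (fun w => φ v w) v).symm
    _ = ∫⁻ u : V, ∫⁻ v : V, φ v (v - u) := by
        refine lintegral_lintegral_swap (Measurable.aemeasurable ?_)
        exact hφ.comp (by fun_prop : Measurable fun p : V × V => (p.1, p.1 - p.2))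
    _ = ∫⁻ u : V, ∫⁻ z : V, φ (z + (1 / 2 : ℝ) • u) (z - (1 / 2 : ℝ) • u) := by
        refine lintegral_congr fun u => ?_
        rw [← lintegral_add_right_eq_self _ ((1 / 2 : ℝ) • u)]
        refine lintegral_congr fun z => ?_
        congr 1
        module
    _ = _ := by
        refine lintegral_lintegral_swap (Measurable.aemeasurable ?_)
        exact hφ.comp (by fun_prop : Measurable fun p : V × V =>
          (p.2 + (1 / 2 : ℝ) • p.1, p.2 - (1 / 2 : ℝ) • p.1))

/-- The collisional change of variables `(v, v_*) ↔ (v', v'_*)` preserves the integral over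
`(v, v_*, σ)`. With `z = (v + v_*)/2` and `v - v_* = rω` the four velocities are `z ± rω/2` and
`z ± rσ/2`, and the measure is `r² dr dω dσ dz`, so the claim is the symmetry between `ω` and
`σ`. -/
theorem lintegral_collision_swap (K : V → V → V → V → ℝ≥0∞)
    (hK : Measurable fun p : V × V × V × V => K p.1 p.2.1 p.2.2.1 p.2.2.2) :
    ∫⁻ v, ∫⁻ vs, ∫⁻ σ, K v vs (vPrime v vs σ) (vsPrime v vs σ) ∂sphereMeasure =
      ∫⁻ v, ∫⁻ vs, ∫⁻ σ, K (vPrime v vs σ) (vsPrime v vs σ) v vs ∂sphereMeasure := by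
  have key : ∀ L : V → V → V → V → ℝ≥0∞,
      Measurable (fun p : V × V × V × V => L p.1 p.2.1 p.2.2.1 p.2.2.2) →
      ∫⁻ v, ∫⁻ vs, ∫⁻ σ, L v vs (vPrime v vs σ) (vsPrime v vs σ) ∂sphereMeasure =
      ∫⁻ z : V, ∫⁻ ω : S2, ∫⁻ σ : S2, ∫⁻ r : Set.Ioi (0 : ℝ),
        L (z + (r / 2 : ℝ) • (ω : V)) (z - (r / 2 : ℝ) • (ω : V)) (z + (r / 2 : ℝ) • (σ : V))
          (z - (r / 2 : ℝ) • (σ : V)) ∂(Measure.volumeIoiPow 2) ∂sphereMeasure ∂sphereMeasure := by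
    intro L hL
    have h1 : Measurable fun p : (V × V) × S2 =>
        L p.1.1 p.1.2 (vPrime p.1.1 p.1.2 p.2) (vsPrime p.1.1 p.1.2 p.2) := by
      have h : Measurable fun p : (V × V) × S2 =>
          (p.1.1, p.1.2, vPrime p.1.1 p.1.2 p.2, vsPrime p.1.1 p.1.2 p.2) := by
        fun_prop
      exact hL.comp h
    rw [lintegral_lintegral_center_relative _ (by exact h1.lintegral_prod_right')]
    refine lintegral_congr fun z => ?_
    rw [lintegral_eq_lintegral_sphere]
    · refine lintegral_congr fun ω => ?_
      rw [lintegral_lintegral_swap]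
      · refine lintegral_congr fun σ => lintegral_congr fun r => ?_
        have hr : (0 : ℝ) < r := r.2
        have e1 : z + (1 / 2 : ℝ) • (r : ℝ) • (ω : V) - (z - (1 / 2 : ℝ) • (r : ℝ) • (ω : V))
            = (r : ℝ) • (ω : V) := by module
        have e2 : ‖(r : ℝ) • (ω : V)‖ = r := by simp [norm_smul, abs_of_pos hr]
        unfold vPrime vsPrime
        rw [e1, e2]
        congr 1 <;> module
      · refine Measurable.aemeasurable ?_
        exact h1.comp (by fun_prop : Measurable fun p : Set.Ioi (0 : ℝ) × S2 =>
          ((z + (1 / 2 : ℝ) • (p.1 : ℝ) • (ω : V), z - (1 / 2 : ℝ) • (p.1 : ℝ) • (ω : V)), p.2))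
    · exact (h1.comp (by fun_prop : Measurable fun p : V × S2 =>
          ((z + (1 / 2 : ℝ) • p.1, z - (1 / 2 : ℝ) • p.1), p.2))).lintegral_prod_right'
  rw [key K hK, key (fun a b c d => K c d a b)
    (hK.comp (by fun_prop : Measurable fun p : V × V × V × V => (p.2.2.1, p.2.2.2, p.1, p.2.1)))]
  refine lintegral_congr fun z => ?_
  rw [lintegral_lintegral_swap]
  refine Measurable.aemeasurable ?_
  exact (hK.comp (by fun_prop : Measurable fun p : (S2 × S2) × Set.Ioi (0 : ℝ) =>
    (z + ((p.2 : ℝ) / 2 : ℝ) • (p.1.1 : V), z - ((p.2 : ℝ) / 2 : ℝ) • (p.1.1 : V),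
      z + ((p.2 : ℝ) / 2 : ℝ) • (p.1.2 : V), z - ((p.2 : ℝ) / 2 : ℝ) • (p.1.2 : V)))).lintegral_prod_right'

/-! ### The deflection map -/

/-- The vector `(u + |u|σ)/2`, which is `v' - v_*` when `u = v - v_*`. -/
def deflect (σ u : V) : V := (1 / 2 : ℝ) • (u + ‖u‖ • σ)

/-- The ratio `|u + |u|σ| / (2|u|)`, which is the cosine of half the angle between `u` and `σ`,
and is `0` for `u = 0`. -/
def halfCos (σ u : V) : ℝ := ‖deflect σ u‖ / ‖u‖

section Measurability

variable {α : Type*} [MeasurableSpace α] {f : α → V} {τ : α → S2}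

@[fun_prop]
theorem measurable_deflect (hτ : Measurable τ) (hf : Measurable f) :
    Measurable fun a => deflect (τ a) (f a) := by
  unfold deflect; fun_prop

@[fun_prop]
theorem measurable_halfCos (hτ : Measurable τ) (hf : Measurable f) :
    Measurable fun a => halfCos (τ a) (f a) := by
  unfold halfCos
  exact (measurable_deflect hτ hf).norm.div hf.norm

end Measurability

theorem halfCos_nonneg (σ u : V) : 0 ≤ halfCos σ u := by unfold halfCos; positivity

theorem halfCos_le_one (σ : S2) (u : V) : halfCos σ u ≤ 1 := by
  refine div_le_one_of_le₀ ?_ (norm_nonneg _)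
  have h : ‖u + ‖u‖ • (σ : V)‖ ≤ ‖u‖ + ‖u‖ := by
    refine (norm_add_le _ _).trans_eq ?_
    simp [norm_smul]
  unfold deflect
  rw [norm_smul, Real.norm_of_nonneg (by norm_num)]
  linarith

theorem halfCos_sq (σ : S2) {u : V} (hu : u ≠ 0) :
    halfCos σ u ^ 2 = (1 + inner ℝ (‖u‖⁻¹ • u) (σ : V)) / 2 := by
  have h : ‖u‖ ≠ 0 := norm_ne_zero_iff.2 hu
  have hs : ‖(σ : V)‖ = 1 := by simp
  unfold halfCos deflect
  rw [norm_smul, div_pow, mul_pow, norm_add_sq_real, norm_smul, hs, inner_smul_right,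
    inner_smul_left]
  simp only [Real.norm_eq_abs, RCLike.conj_to_real]
  field_simp
  norm_num
  ring

theorem hasFDerivAt_deflect (σ : V) {u : V} (hu : u ≠ 0) :
    HasFDerivAt (deflect σ) ((1 / 2 : ℝ) • (ContinuousLinearMap.id ℝ V +
      (innerSL ℝ (‖u‖⁻¹ • u)).smulRight σ)) u := by
  have h0 : ‖u‖ ≠ 0 := norm_ne_zero_iff.2 hu
  have h1 : HasFDerivAt (fun x : V => ‖x‖) (innerSL ℝ (‖u‖⁻¹ • u)) u := by
    have h2 := ((hasStrictFDerivAt_norm_sq u).hasFDerivAt).sqrt (by positivity)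
    simp only [Real.sqrt_sq (norm_nonneg _)] at h2
    have e : innerSL ℝ (‖u‖⁻¹ • u) = (1 / (2 * ‖u‖)) • 2 • innerSL ℝ u := by
      rw [map_smul, ← Nat.cast_smul_eq_nsmul ℝ, smul_smul]
      congr 1
      push_cast
      field_simp
    rw [e]
    exact h2
  exact ((hasFDerivAt_id u).add (h1.smul_const σ)).const_smul (1 / 2 : ℝ)

theorem det_fderiv_deflect (σ : S2) {u : V} (hu : u ≠ 0) :
    ((1 / 2 : ℝ) • (ContinuousLinearMap.id ℝ V +
      (innerSL ℝ (‖u‖⁻¹ • u)).smulRight (σ : V))).det = halfCos σ u ^ 2 / 4 := by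
  have h : (((1 / 2 : ℝ) • (ContinuousLinearMap.id ℝ V +
      (innerSL ℝ (‖u‖⁻¹ • u)).smulRight (σ : V)) : V →L[ℝ] V) : V →ₗ[ℝ] V) =
      (1 / 2 : ℝ) • LinearMap.transvection (innerₛₗ ℝ (‖u‖⁻¹ • u)) (σ : V) := by
    ext x
    simp [LinearMap.transvection]
  rw [ContinuousLinearMap.det, h, LinearMap.det_smul, LinearMap.transvection.det, halfCos_sq σ hu,
    innerₛₗ_apply_apply, finrank_euclideanSpace_fin]
  ring

/-- The change of variables `w = (u + |u|σ)/2` has Jacobian `s²/4`, where `s` is the half-angle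
cosine, so the weight `s^p` with `p ≥ 2` absorbs the singularity of the inverse Jacobian at
`s = 0`. -/
theorem lintegral_comp_deflect_le (σ : S2) {p : ℝ} (hp : 2 ≤ p) (H : V → ℝ≥0∞) :
    ∫⁻ u : V, H (deflect σ u) * ENNReal.ofReal (halfCos σ u ^ p) ≤ 4 * ∫⁻ w, H w := by
  have hs : ‖(σ : V)‖ = 1 := by simp
  set U : Set V := {u | deflect σ u ≠ 0} with hU
  have hUm : MeasurableSet U := by
    have : Measurable (deflect (σ : V)) := by unfold deflect; fun_prop
    exact (this (measurableSet_singleton 0)).compl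
  have hne : ∀ u ∈ U, u ≠ 0 := by
    rintro u hu rfl
    exact hu (by simp [deflect])
  have hinj : Set.InjOn (deflect (σ : V)) U := by
    -- the image determines `|u|`, since `|w|² = |u| ⟨w, σ⟩` for `w = (u + |u|σ)/2`
    have hn : ∀ u : V, ‖deflect σ u‖ ^ 2 = ‖u‖ * inner ℝ (deflect σ u) (σ : V) := by
      intro u
      unfold deflect
      rw [norm_smul, mul_pow, norm_add_sq_real, norm_smul, hs, inner_smul_right, inner_smul_left,
        inner_add_left, inner_smul_left, real_inner_self_eq_norm_sq, hs]
      simp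
      ring
    intro u hu u' hu' h
    have e1 := hn u
    have e2 := hn u'
    rw [h] at e1
    have h3 : ‖u‖ = ‖u'‖ := by
      have hz : inner ℝ (deflect σ u') (σ : V) ≠ 0 := by
        intro h0
        rw [h0, mul_zero] at e2
        exact hu' (by simpa using e2)
      exact mul_right_cancel₀ hz (e1.symm.trans e2)
    unfold deflect at h
    rw [h3] at h
    have h4 := smul_right_injective V (by norm_num : (1 / 2 : ℝ) ≠ 0) h
    exact add_right_cancel h4
  have hcov := lintegral_image_eq_lintegral_abs_det_fderiv_mul volume hUm
    (fun u hu => (hasFDerivAt_deflect (σ : V) (hne u hu)).hasFDerivWithinAt) hinj H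
  calc ∫⁻ u : V, H (deflect σ u) * ENNReal.ofReal (halfCos σ u ^ p)
      ≤ ∫⁻ u : V, U.indicator (fun u => 4 * (ENNReal.ofReal |((1 / 2 : ℝ) •
        (ContinuousLinearMap.id ℝ V + (innerSL ℝ (‖u‖⁻¹ • u)).smulRight (σ : V))).det| *
          H (deflect σ u))) u := by
        refine lintegral_mono fun u => ?_
        by_cases hu : u ∈ U
        · simp only [Set.indicator_of_mem hu]
          rw [det_fderiv_deflect σ (hne u hu), abs_of_nonneg (by positivity), ← mul_assoc,
            show (4 : ℝ≥0∞) = ENNReal.ofReal 4 by simp, ← ENNReal.ofReal_mul (by norm_num),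
            mul_comm]
          gcongr
          have := Real.rpow_le_rpow_of_exponent_ge' (halfCos_nonneg σ u) (halfCos_le_one σ u)
            (by norm_num) hp
          rw [Real.rpow_two] at this
          linarith
        · have : deflect σ u = 0 := by simpa [hU] using hu
          have h0 : halfCos σ u = 0 := by simp [halfCos, this]
          rw [h0, Real.zero_rpow (by linarith)]
          simp
    _ = 4 * ∫⁻ w in deflect (σ : V) '' U, H w := by
        rw [lintegral_indicator hUm, lintegral_const_mul' _ _ (by norm_num), hcov]
    _ ≤ 4 * ∫⁻ w, H w := by
        gcongr
        exact Measure.restrict_le_self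

/-! ### Concentration of powers of the half-angle cosine on the sphere -/

theorem le_volumeIoiPow_two_shell {δ : ℝ} (hδ : 0 ≤ δ) :
    ENNReal.ofReal δ ≤ Measure.volumeIoiPow 2
      {r : Set.Ioi (0 : ℝ) | 1 ≤ (r : ℝ) ∧ (r : ℝ) < 1 + δ} := by
  have hset : {r : Set.Ioi (0 : ℝ) | 1 ≤ (r : ℝ) ∧ (r : ℝ) < 1 + δ} =
      Set.Iio (⟨1 + δ, by rw [Set.mem_Ioi]; positivity⟩ : Set.Ioi (0 : ℝ)) \
        Set.Iio (⟨1, by simp⟩ : Set.Ioi (0 : ℝ)) := by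
    ext r
    simp only [Set.mem_ofPred_eq, Set.mem_sdiff, Set.mem_Iio, ← Subtype.coe_lt_coe, not_lt]
    exact and_comm
  rw [hset, measure_sdiff _ measurableSet_Iio.nullMeasurableSet, Measure.volumeIoiPow_apply_Iio,
    Measure.volumeIoiPow_apply_Iio, ← ENNReal.ofReal_sub _ (by norm_num)]
  · refine ENNReal.ofReal_le_ofReal ?_
    norm_num
    nlinarith [mul_nonneg hδ hδ, mul_nonneg hδ (mul_nonneg hδ hδ)]
  · rw [Measure.volumeIoiPow_apply_Iio]; exact ENNReal.ofReal_ne_top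
  · intro r hr
    have : (r : ℝ) < 1 := hr
    exact this.trans_le (by simpa using hδ)

/-- A Gaussian of variance `1/p` centred at a point of the sphere has integral `O(1/p)` over the
sphere: thicken the sphere to a shell of width `1/√p` and compare with the integral over the
whole space, which is of order `p^{-3/2}`. -/
theorem lintegral_sphere_gaussian_le {p : ℝ} (hp : 1 ≤ p) (ω : V) :
    ∫⁻ σ : S2, ENNReal.ofReal (Real.exp (-(p / 8) * ‖(σ : V) - ω‖ ^ 2)) ∂sphereMeasure ≤
      ENNReal.ofReal (Real.exp 1 * (16 * Real.pi) ^ (3 / 2 : ℝ) / p) := by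
  have hp0 : 0 < p := by linarith
  set δ : ℝ := 1 / Real.sqrt p with hδ
  have hδ0 : 0 < δ := by positivity
  have hδ2 : p * δ ^ 2 = 1 := by
    rw [hδ, div_pow, Real.sq_sqrt hp0.le]; field_simp
  set S : Set (Set.Ioi (0 : ℝ)) := {r | 1 ≤ (r : ℝ) ∧ (r : ℝ) < 1 + δ} with hS
  have hSm : MeasurableSet S := by
    refine (measurableSet_le measurable_const measurable_subtype_coe).inter
      (measurableSet_lt measurable_subtype_coe measurable_const)
  set E : S2 → ℝ≥0∞ := fun σ => ENNReal.ofReal (Real.exp (-(p / 8) * ‖(σ : V) - ω‖ ^ 2)) with hE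
  have hEm : Measurable E := by fun_prop
  have hpt : ∀ (σ : S2) (r : Set.Ioi (0 : ℝ)), S.indicator (fun _ => E σ) r ≤
      ENNReal.ofReal (Real.exp 1 * Real.exp (-(p / 16) * ‖(r : ℝ) • (σ : V) - ω‖ ^ 2)) := by
    intro σ r
    by_cases hr : r ∈ S
    · rw [Set.indicator_of_mem hr]
      refine ENNReal.ofReal_le_ofReal ?_
      rw [← Real.exp_add]
      refine Real.exp_le_exp.2 ?_
      have h1 : ‖(r : ℝ) • (σ : V) - ω‖ ≤ ‖(σ : V) - ω‖ + δ := by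
        have : (r : ℝ) • (σ : V) - ω = ((σ : V) - ω) + ((r : ℝ) - 1) • (σ : V) := by module
        rw [this]
        refine (norm_add_le _ _).trans ?_
        have h2 : ‖((r : ℝ) - 1) • (σ : V)‖ = (r : ℝ) - 1 := by
          rw [norm_smul, Real.norm_of_nonneg (by linarith [hr.1])]; simp
        rw [h2]
        linarith [hr.2]
      have h3 : ‖(r : ℝ) • (σ : V) - ω‖ ^ 2 ≤ 2 * ‖(σ : V) - ω‖ ^ 2 + 2 * δ ^ 2 := by
        have := pow_le_pow_left₀ (norm_nonneg _) h1 2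
        nlinarith [sq_nonneg (‖(σ : V) - ω‖ - δ)]
      have h4 := mul_le_mul_of_nonneg_left h3 hp0.le
      nlinarith
    · rw [Set.indicator_of_notMem hr]; exact zero_le
  have hint : Integrable fun x : V => Real.exp (-(p / 16) * ‖x‖ ^ 2) := by
    have := GaussianFourier.integrable_cexp_neg_mul_sq_norm_add
      (b := ((p / 16 : ℝ) : ℂ)) (by simpa using hp0) 0 (0 : V)
    refine this.norm.congr (Filter.Eventually.of_forall fun x => ?_)
    simp [Complex.norm_exp, ← Complex.ofReal_pow]
  have hgauss : ∫⁻ x : V, ENNReal.ofReal (Real.exp 1 * Real.exp (-(p / 16) * ‖x - ω‖ ^ 2)) =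
      ENNReal.ofReal (Real.exp 1 * (16 * Real.pi) ^ (3 / 2 : ℝ) / (p * Real.sqrt p)) := by
    rw [lintegral_sub_right_eq_self (fun x : V =>
      ENNReal.ofReal (Real.exp 1 * Real.exp (-(p / 16) * ‖x‖ ^ 2))) ω,
      ← ofReal_integral_eq_lintegral_ofReal (hint.const_mul _)
        (Filter.Eventually.of_forall fun x => by positivity), integral_const_mul,
      GaussianFourier.integral_rexp_neg_mul_sq_norm (by positivity), finrank_euclideanSpace_fin]
    congr 1
    have : Real.pi / (p / 16) = (16 * Real.pi) / p := by field_simp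
    rw [this, Real.div_rpow (by positivity) hp0.le]
    have h32 : p ^ ((3 : ℕ) / 2 : ℝ) = p * Real.sqrt p := by
      rw [Real.sqrt_eq_rpow, ← Real.rpow_one_add' hp0.le (by norm_num)]; norm_num
    rw [h32, mul_div_assoc]
    norm_num
  have hmain : ENNReal.ofReal δ * ∫⁻ σ, E σ ∂sphereMeasure ≤
      ENNReal.ofReal (Real.exp 1 * (16 * Real.pi) ^ (3 / 2 : ℝ) / (p * Real.sqrt p)) := by
    calc ENNReal.ofReal δ * ∫⁻ σ, E σ ∂sphereMeasure
        ≤ ∫⁻ σ : S2, ∫⁻ r, S.indicator (fun _ => E σ) r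
            ∂(Measure.volumeIoiPow 2) ∂sphereMeasure := by
          rw [← lintegral_const_mul _ hEm]
          refine lintegral_mono fun σ => ?_
          rw [lintegral_indicator hSm, setLIntegral_const, mul_comm]
          gcongr
          exact le_volumeIoiPow_two_shell hδ0.le
      _ ≤ ∫⁻ σ : S2, ∫⁻ r : Set.Ioi (0 : ℝ),
            ENNReal.ofReal (Real.exp 1 * Real.exp (-(p / 16) * ‖(r : ℝ) • (σ : V) - ω‖ ^ 2))
            ∂(Measure.volumeIoiPow 2) ∂sphereMeasure :=
          lintegral_mono fun σ => lintegral_mono fun r => hpt σ r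
      _ = _ := by
          rw [← hgauss, lintegral_eq_lintegral_sphere]
          fun_prop
  have h5 : ∫⁻ σ, E σ ∂sphereMeasure = ENNReal.ofReal (Real.sqrt p) *
      (ENNReal.ofReal δ * ∫⁻ σ, E σ ∂sphereMeasure) := by
    rw [← mul_assoc, ← ENNReal.ofReal_mul (by positivity)]
    have : Real.sqrt p * δ = 1 := by rw [hδ]; field_simp
    rw [this]; simp
  rw [h5]
  refine (mul_le_mul_right hmain _).trans_eq ?_
  rw [← ENNReal.ofReal_mul (by positivity)]
  congr 1
  field_simp

/-- The half-angle cosine `s` satisfies `s² = 1 - |σ - u/|u||²/4`, hence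
`s^p ≤ exp(-p|σ - u/|u||²/8)`: large powers of it concentrate near `σ = u/|u|`. -/
theorem lintegral_sphere_halfCos_rpow_le {p : ℝ} (hp : 1 ≤ p) (u : V) :
    ∫⁻ σ : S2, ENNReal.ofReal (halfCos σ u ^ p) ∂sphereMeasure ≤
      ENNReal.ofReal (Real.exp 1 * (16 * Real.pi) ^ (3 / 2 : ℝ) / p) := by
  by_cases hu : u = 0
  · subst hu
    simp [halfCos, Real.zero_rpow (by linarith : p ≠ 0)]
  refine (lintegral_mono fun σ => ?_).trans (lintegral_sphere_gaussian_le hp (‖u‖⁻¹ • u))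
  refine ENNReal.ofReal_le_ofReal ?_
  have hs : ‖(σ : V)‖ = 1 := by simp
  have hu1 : ‖‖u‖⁻¹ • u‖ = 1 := by simp [norm_smul, hu]
  have h1 : halfCos σ u ^ 2 ≤ Real.exp (-(1 / 8) * ‖(σ : V) - ‖u‖⁻¹ • u‖ ^ 2) ^ 2 := by
    rw [halfCos_sq σ hu, ← Real.exp_nat_mul, norm_sub_sq_real, hs, hu1,
      real_inner_comm (‖u‖⁻¹ • u) (σ : V)]
    refine le_trans (le_of_eq ?_) (Real.add_one_le_exp _)
    push_cast
    ring
  have h2 := (sq_le_sq₀ (halfCos_nonneg _ _) (Real.exp_pos _).le).1 h1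
  calc halfCos σ u ^ p ≤ Real.exp (-(1 / 8) * ‖(σ : V) - ‖u‖⁻¹ • u‖ ^ 2) ^ p :=
        Real.rpow_le_rpow (halfCos_nonneg _ _) h2 (by linarith)
    _ = _ := by
        rw [← Real.exp_mul]
        congr 1
        ring

/-! ### A trilinear estimate with angular weight -/

/-- The `L²` norm of a function with values in `[0, ∞]`. -/
def l2 (F : V → ℝ≥0∞) : ℝ≥0∞ := (∫⁻ v, F v ^ (2 : ℝ)) ^ (1 / 2 : ℝ)

theorem l2_comp_add_left (F : V → ℝ≥0∞) (x : V) : l2 (fun v => F (x + v)) = l2 F := by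
  unfold l2
  rw [lintegral_add_left_eq_self (fun v => F v ^ (2 : ℝ)) x]

theorem lintegral_mul_le_l2_mul_l2 {F G : V → ℝ≥0∞} (hF : Measurable F) (hG : Measurable G) :
    ∫⁻ v, F v * G v ≤ l2 F * l2 G :=
  ENNReal.lintegral_mul_le_Lp_mul_Lq volume Real.HolderConjugate.two_two
    hF.aemeasurable hG.aemeasurable

theorem vPrime_eq_add_deflect (v vs : V) (σ : S2) :
    vPrime v vs σ = vs + deflect σ (v - vs) := by
  unfold vPrime deflect; module

theorem vPrime_comm (v vs : V) (σ : S2) : vPrime v vs σ = vPrime vs v σ := by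
  unfold vPrime; rw [norm_sub_rev, add_comm v vs]

/-- By Cauchy–Schwarz the bilinear form is bounded by the geometric mean of two integrals: in the
one with `G` the angular integral gains `1/p`, the one with `H` is controlled by the change of
variables `u ↦ (u + |u|σ)/2`. -/
theorem exists_bilinear_deflect_bound : ∃ C : ℝ, 0 < C ∧ ∀ p : ℝ, 2 ≤ p →
    ∀ G H : V → ℝ≥0∞, Measurable G → Measurable H →
      ∫⁻ u : V, ∫⁻ σ : S2, G u * H (deflect σ u) * ENNReal.ofReal (halfCos σ u ^ p) ∂sphereMeasure
        ≤ ENNReal.ofReal (C / Real.sqrt p) * (l2 G * l2 H) := by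
  set c₀ : ℝ := Real.exp 1 * (16 * Real.pi) ^ (3 / 2 : ℝ) with hc₀
  have hc₀pos : 0 < c₀ := by positivity
  set m : ℝ := sphereMeasure.real Set.univ with hm
  have hmE : sphereMeasure Set.univ = ENNReal.ofReal m := by
    rw [hm, ofReal_measureReal]
  have hm0 : 0 ≤ m := measureReal_nonneg
  refine ⟨(c₀ * (4 * m)) ^ (1 / 2 : ℝ) + 1, by positivity, fun p hp G H hG hH => ?_⟩
  have hp0 : 0 < p := by linarith
  have hw : ∀ q : ℝ, Measurable fun z : V × S2 => ENNReal.ofReal (halfCos z.2 z.1 ^ q) :=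
    fun q => by fun_prop
  have hHd : Measurable fun z : V × S2 => H (deflect z.2 z.1) := by fun_prop
  set A : V × S2 → ℝ≥0∞ := fun z => G z.1 * ENNReal.ofReal (halfCos z.2 z.1 ^ (p / 2)) with hA
  set B : V × S2 → ℝ≥0∞ := fun z =>
    H (deflect z.2 z.1) * ENNReal.ofReal (halfCos z.2 z.1 ^ (p / 2)) with hB
  have hAm : Measurable A := (hG.comp measurable_fst).mul (hw _)
  have hBm : Measurable B := hHd.mul (hw _)
  have hhalf : ∀ z : V × S2, ENNReal.ofReal (halfCos z.2 z.1 ^ (p / 2)) ^ (2 : ℝ) =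
      ENNReal.ofReal (halfCos z.2 z.1 ^ p) := by
    intro z
    rw [ENNReal.ofReal_rpow_of_nonneg (Real.rpow_nonneg (halfCos_nonneg _ _) _) (by norm_num),
      ← Real.rpow_mul (halfCos_nonneg _ _)]
    congr 2
    ring
  have hA2 : ∫⁻ z, A z ^ (2 : ℝ) ∂(volume.prod sphereMeasure) ≤
      ENNReal.ofReal (c₀ / p) * ∫⁻ v, G v ^ (2 : ℝ) := by
    rw [lintegral_prod _ (hAm.pow_const _).aemeasurable,
      ← lintegral_const_mul _ (hG.pow_const _)]
    refine lintegral_mono fun u => ?_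
    simp only [hA, ENNReal.mul_rpow_of_nonneg _ _ (by norm_num : (0 : ℝ) ≤ 2)]
    simp only [fun σ : S2 => hhalf (u, σ)]
    rw [lintegral_const_mul _ (by fun_prop), mul_comm]
    gcongr
    exact lintegral_sphere_halfCos_rpow_le (by linarith) u
  have hB2 : ∫⁻ z, B z ^ (2 : ℝ) ∂(volume.prod sphereMeasure) ≤
      ENNReal.ofReal (4 * m) * ∫⁻ v, H v ^ (2 : ℝ) := by
    rw [lintegral_prod_symm _ (hBm.pow_const _).aemeasurable]
    calc _ ≤ ∫⁻ σ : S2, (4 * ∫⁻ v, H v ^ (2 : ℝ)) ∂sphereMeasure := by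
          refine lintegral_mono fun σ => ?_
          simp only [hB, ENNReal.mul_rpow_of_nonneg _ _ (by norm_num : (0 : ℝ) ≤ 2)]
          simp only [fun u : V => hhalf (u, σ)]
          exact lintegral_comp_deflect_le σ hp (fun w => H w ^ (2 : ℝ))
      _ = _ := by
          rw [lintegral_const, hmE, ENNReal.ofReal_mul (by norm_num)]
          simp only [ENNReal.ofReal_ofNat]
          ring
  calc ∫⁻ u : V, ∫⁻ σ : S2, G u * H (deflect σ u) * ENNReal.ofReal (halfCos σ u ^ p)
        ∂sphereMeasure
      = ∫⁻ z, (A * B) z ∂(volume.prod sphereMeasure) := by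
        rw [lintegral_prod _ (hAm.mul hBm).aemeasurable]
        refine lintegral_congr fun u => lintegral_congr fun σ => ?_
        have := hhalf (u, σ)
        rw [ENNReal.rpow_two, sq] at this
        simp only [Pi.mul_apply, hA, hB, ← this]
        ring
    _ ≤ (∫⁻ z, A z ^ (2 : ℝ) ∂(volume.prod sphereMeasure)) ^ (1 / 2 : ℝ) *
          (∫⁻ z, B z ^ (2 : ℝ) ∂(volume.prod sphereMeasure)) ^ (1 / 2 : ℝ) :=
        ENNReal.lintegral_mul_le_Lp_mul_Lq _ Real.HolderConjugate.two_two
          hAm.aemeasurable hBm.aemeasurable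
    _ ≤ (ENNReal.ofReal (c₀ / p) * ∫⁻ v, G v ^ (2 : ℝ)) ^ (1 / 2 : ℝ) *
          (ENNReal.ofReal (4 * m) * ∫⁻ v, H v ^ (2 : ℝ)) ^ (1 / 2 : ℝ) := by
        gcongr
    _ = (ENNReal.ofReal (c₀ / p) * ENNReal.ofReal (4 * m)) ^ (1 / 2 : ℝ) * (l2 G * l2 H) := by
        unfold l2
        simp only [ENNReal.mul_rpow_of_nonneg _ _ (by norm_num : (0 : ℝ) ≤ 1 / 2)]
        ring
    _ ≤ _ := by
        gcongr
        rw [← ENNReal.ofReal_mul (by positivity),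
          ENNReal.ofReal_rpow_of_nonneg (by positivity) (by norm_num)]
        refine ENNReal.ofReal_le_ofReal ?_
        have : c₀ / p * (4 * m) = c₀ * (4 * m) / p := by ring
        rw [this, Real.div_rpow (by positivity) hp0.le, Real.sqrt_eq_rpow]
        gcongr
        linarith

/-- With `v_*` fixed, `v' = v_* + (u + |u|σ)/2` for `u = v - v_*`, and the bilinear bound applies to
the translates of `G` and `H` by `v_*`. -/
theorem exists_trilinear_bound : ∃ C : ℝ, 0 < C ∧ ∀ p : ℝ, 2 ≤ p →
    ∀ F G H : V → ℝ≥0∞, Measurable F → Measurable G → Measurable H →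
      ∫⁻ v : V, ∫⁻ vs : V, ∫⁻ σ : S2, ENNReal.ofReal (halfCos σ (v - vs) ^ p) *
          (F vs * G v * H (vPrime v vs σ)) ∂sphereMeasure
        ≤ ENNReal.ofReal (C / Real.sqrt p) * ((∫⁻ v, F v) * l2 G * l2 H) := by
  obtain ⟨C, hC, h⟩ := exists_bilinear_deflect_bound
  refine ⟨C, hC, fun p hp F G H hF hG hH => ?_⟩
  have hm : Measurable fun z : (V × V) × S2 =>
      ENNReal.ofReal (halfCos z.2 (z.1.1 - z.1.2) ^ p) *
        (F z.1.2 * G z.1.1 * H (vPrime z.1.1 z.1.2 z.2)) := by fun_prop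
  rw [lintegral_lintegral_swap (by exact hm.lintegral_prod_right'.aemeasurable)]
  calc _ ≤ ∫⁻ x, F x * (ENNReal.ofReal (C / Real.sqrt p) * (l2 G * l2 H)) := by
        refine lintegral_mono fun x => ?_
        have hx := h p hp (fun u => G (x + u)) (fun u => H (x + u))
          (hG.comp (measurable_const_add x)) (hH.comp (measurable_const_add x))
        rw [l2_comp_add_left, l2_comp_add_left] at hx
        refine le_trans (le_of_eq ?_) (mul_le_mul_right hx (F x))
        have hm2 : Measurable fun z : V × S2 =>
            G (x + z.1) * H (x + deflect z.2 z.1) * ENNReal.ofReal (halfCos z.2 z.1 ^ p) := by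
          fun_prop
        rw [← lintegral_const_mul _ (by exact hm2.lintegral_prod_right'),
          ← lintegral_add_left_eq_self _ x]
        refine lintegral_congr fun u => ?_
        rw [← lintegral_const_mul _ (by fun_prop)]
        refine lintegral_congr fun σ => ?_
        rw [vPrime_eq_add_deflect, add_sub_cancel_left]
        ring
    _ = _ := by
        rw [lintegral_mul_const _ hF]
        ring

/-- The version of the trilinear estimate in which the roles of `v` and `v_*` are exchanged. -/
theorem exists_trilinear_bound_symm : ∃ C : ℝ, 0 < C ∧ ∀ p : ℝ, 2 ≤ p →
    ∀ F G H : V → ℝ≥0∞, Measurable F → Measurable G → Measurable H →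
      ∫⁻ v : V, ∫⁻ vs : V, ∫⁻ σ : S2, ENNReal.ofReal (halfCos σ (v - vs) ^ p) *
          (F vs * G v * H (vPrime v vs σ)) ∂sphereMeasure
        ≤ ENNReal.ofReal (C / Real.sqrt p) * ((∫⁻ v, F v) * l2 G * l2 H) ∧
      ∫⁻ v : V, ∫⁻ vs : V, ∫⁻ σ : S2, ENNReal.ofReal (halfCos σ (vs - v) ^ p) *
          (G vs * F v * H (vPrime v vs σ)) ∂sphereMeasure
        ≤ ENNReal.ofReal (C / Real.sqrt p) * ((∫⁻ v, F v) * l2 G * l2 H) := by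
  obtain ⟨C, hC, h⟩ := exists_trilinear_bound
  refine ⟨C, hC, fun p hp F G H hF hG hH => ⟨h p hp F G H hF hG hH, ?_⟩⟩
  have hm : Measurable fun z : (V × V) × S2 =>
      ENNReal.ofReal (halfCos z.2 (z.1.2 - z.1.1) ^ p) *
        (G z.1.2 * F z.1.1 * H (vPrime z.1.1 z.1.2 z.2)) := by fun_prop
  rw [lintegral_lintegral_swap (by exact hm.lintegral_prod_right'.aemeasurable)]
  refine le_trans (le_of_eq ?_) (h p hp F G H hF hG hH)
  refine lintegral_congr fun v => lintegral_congr fun vs => lintegral_congr fun σ => ?_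
  rw [vPrime_comm vs v, mul_comm (G v)]

/-! ### Pointwise inequalities for the weights -/

theorem one_le_jap (v : V) : 1 ≤ jap v := by
  unfold jap
  exact Real.one_le_sqrt.2 (by nlinarith [sq_nonneg ‖v‖])

theorem jap_pos (v : V) : 0 < jap v := zero_lt_one.trans_le (one_le_jap v)

@[fun_prop]
theorem continuous_jap : Continuous jap := by unfold jap; fun_prop

theorem norm_le_jap (v : V) : ‖v‖ ≤ jap v := by
  unfold jap
  exact Real.le_sqrt_of_sq_le (by linarith)

theorem norm_sub_le_two_mul_jap (v w : V) : ‖v - w‖ ≤ 2 * jap v * jap w := by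
  have h1 := one_le_jap v
  have h2 := one_le_jap w
  have := (norm_sub_le v w).trans (add_le_add (norm_le_jap v) (norm_le_jap w))
  nlinarith

/-- Ptolemy's inequality for the points `(v, 0)`, `(w, 0)`, `(x, 0)` and `(0, 1)` of `ℝ³ × ℝ`: the
distance from `(0, 1)` to `(v, 0)` is the Japanese bracket of `v`. -/
theorem norm_sub_mul_jap_le (v w x : V) :
    ‖v - w‖ * jap x ≤ ‖x - w‖ * jap v + ‖x - v‖ * jap w := by
  have hd : ∀ y z : V, dist (WithLp.toLp 2 (y, (0 : ℝ))) (WithLp.toLp 2 (z, (0 : ℝ))) =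
      ‖y - z‖ := by
    intro y z
    rw [WithLp.prod_dist_eq_of_L2]
    simp [dist_eq_norm]
  have hj : ∀ y : V, dist (WithLp.toLp 2 (y, (0 : ℝ))) (WithLp.toLp 2 ((0 : V), (1 : ℝ))) =
      jap y := by
    intro y
    rw [WithLp.prod_dist_eq_of_L2]
    simp [dist_eq_norm, jap, add_comm]
  have h := EuclideanGeometry.mul_dist_le_mul_dist_add_mul_dist
    (WithLp.toLp 2 (v, (0 : ℝ))) (WithLp.toLp 2 (x, (0 : ℝ))) (WithLp.toLp 2 (w, (0 : ℝ)))
    (WithLp.toLp 2 ((0 : V), (1 : ℝ)))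
  rw [hd, hj, hd, hj, hd, hj, norm_sub_rev v x] at h
  linarith

theorem norm_sub_mul_halfCos (v vs : V) (σ : S2) :
    ‖v - vs‖ * halfCos σ (v - vs) = ‖vPrime v vs σ - vs‖ := by
  rw [vPrime_eq_add_deflect, add_sub_cancel_left]
  unfold halfCos
  by_cases h : ‖v - vs‖ = 0
  · have : v - vs = 0 := norm_eq_zero.1 h
    simp [this, deflect]
  · field_simp

/-- The bracket `⟨v'⟩` is at most a combination of `⟨v⟩` and `⟨v_*⟩` whose coefficients are the
half-angle cosine and sine. The case `v = v_*` is excluded, both coefficients being `0` there by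
convention. -/
theorem jap_vPrime_le {v vs : V} (h : v ≠ vs) (σ : S2) :
    jap (vPrime v vs σ) ≤ halfCos σ (v - vs) * jap v + halfCos σ (vs - v) * jap vs := by
  have hr : 0 < ‖v - vs‖ := norm_pos_iff.2 (sub_ne_zero.2 h)
  have h1 := norm_sub_mul_jap_le v vs (vPrime v vs σ)
  have h2 := norm_sub_mul_halfCos vs v σ
  rw [← vPrime_comm, norm_sub_rev] at h2
  rw [← norm_sub_mul_halfCos, ← h2] at h1
  refine le_of_mul_le_mul_left (h1.trans_eq ?_) hr
  ring

/-- The constant in the inequality `add_rpow_le`. -/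
def crossConst (k : ℝ) : ℝ := k * 2 ^ (k - 1)

theorem add_rpow_le_of_le {x y k : ℝ} (hy : 0 ≤ y) (hyx : y ≤ x) (hk : 1 ≤ k) :
    (x + y) ^ k ≤ x ^ k + crossConst k * (x ^ (k - 1) * y) := by
  have hx : 0 ≤ x := hy.trans hyx
  rcases (add_nonneg hx hy).eq_or_lt with h0 | h0
  · have hx0 : x = 0 := by linarith
    have hy0 : y = 0 := by linarith
    simp [hx0, hy0]
  -- Bernoulli's inequality for `x / (x + y) = 1 - y / (x + y)`
  have hb := one_add_mul_self_le_rpow_one_add (s := -(y / (x + y))) (p := k)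
    (by rw [neg_le_neg_iff]; exact div_le_one_of_le₀ (by linarith) h0.le) hk
  have e : 1 + -(y / (x + y)) = x / (x + y) := by field_simp; ring
  rw [e, Real.div_rpow hx h0.le, le_div_iff₀ (Real.rpow_pos_of_pos h0 k)] at hb
  have h1 : (x + y) ^ (k - 1) ≤ 2 ^ (k - 1) * x ^ (k - 1) := by
    rw [← Real.mul_rpow (by norm_num) hx]
    exact Real.rpow_le_rpow h0.le (by linarith) (by linarith)
  have h2 : (x + y) ^ k = (x + y) ^ (k - 1) * (x + y) := by
    rw [← Real.rpow_add_one h0.ne']; congr 1; ring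
  have h3 : (1 + k * -(y / (x + y))) * (x + y) ^ k =
      (x + y) ^ k - k * y * (x + y) ^ (k - 1) := by
    rw [h2]; field_simp; ring
  have h4 : k * y * (x + y) ^ (k - 1) ≤ k * y * (2 ^ (k - 1) * x ^ (k - 1)) := by gcongr
  unfold crossConst
  nlinarith

theorem crossConst_nonneg {k : ℝ} (hk : 0 ≤ k) : 0 ≤ crossConst k := by
  unfold crossConst; positivity

theorem add_rpow_le {x y k : ℝ} (hx : 0 ≤ x) (hy : 0 ≤ y) (hk : 1 ≤ k) :
    (x + y) ^ k ≤ x ^ k + y ^ k + crossConst k * (x ^ (k - 1) * y + y ^ (k - 1) * x) := by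
  have hM := crossConst_nonneg (by linarith : 0 ≤ k)
  rcases le_total y x with h | h
  · have h1 := add_rpow_le_of_le hy h hk
    have h2 : 0 ≤ y ^ k + crossConst k * (y ^ (k - 1) * x) := by positivity
    linarith
  · have h1 := add_rpow_le_of_le hx h hk
    rw [add_comm y x] at h1
    have h2 : 0 ≤ x ^ k + crossConst k * (x ^ (k - 1) * y) := by positivity
    linarith

/-- The kinetic factor `r^γ` is distributed over the three velocities: the part `r^θ` is combined
with the angular factor, since `r s = |v' - v_*|`. -/
theorem rpow_mul_rpow_le {r s a b d γ θ k : ℝ} (hr : 0 ≤ r) (hs : 0 ≤ s) (hs1 : s ≤ 1)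
    (ha : 0 ≤ a) (hb : 0 ≤ b) (hd : 0 ≤ d) (hrab : r ≤ 2 * a * b) (hrs : r * s ≤ 2 * d * b)
    (hθ : 0 ≤ θ) (hθγ : θ ≤ γ) (hγ : γ ≤ 1) (hk : 2 ≤ k) :
    r ^ γ * s ^ k ≤ 2 * (s ^ (k - 1) * (a ^ (γ - θ) * b ^ γ * d ^ θ)) := by
  have e1 : r ^ γ = r ^ (γ - θ) * r ^ θ := by
    rw [← Real.rpow_add_of_nonneg hr (by linarith) hθ]; congr 1; ring
  have e2 : s ^ k = s ^ θ * s ^ (k - θ) := by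
    rw [← Real.rpow_add_of_nonneg hs hθ (by linarith)]; congr 1; ring
  have e3 : b ^ γ = b ^ (γ - θ) * b ^ θ := by
    rw [← Real.rpow_add_of_nonneg hb (by linarith) hθ]; congr 1; ring
  have h1 : r ^ (γ - θ) ≤ 2 ^ (γ - θ) * a ^ (γ - θ) * b ^ (γ - θ) := by
    rw [← Real.mul_rpow (by norm_num) ha, ← Real.mul_rpow (by positivity) hb]
    exact Real.rpow_le_rpow hr hrab (by linarith)
  have h2 : r ^ θ * s ^ θ ≤ 2 ^ θ * d ^ θ * b ^ θ := by
    rw [← Real.mul_rpow hr hs, ← Real.mul_rpow (by norm_num) hd,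
      ← Real.mul_rpow (by positivity) hb]
    exact Real.rpow_le_rpow (by positivity) hrs hθ
  have h3 : s ^ (k - θ) ≤ s ^ (k - 1) :=
    Real.rpow_le_rpow_of_exponent_ge' hs hs1 (by linarith) (by linarith)
  have h4 : (2 : ℝ) ^ (γ - θ) * 2 ^ θ ≤ 2 := by
    rw [← Real.rpow_add (by norm_num)]
    calc (2 : ℝ) ^ (γ - θ + θ) ≤ 2 ^ (1 : ℝ) :=
          Real.rpow_le_rpow_of_exponent_le (by norm_num) (by linarith)
      _ = 2 := Real.rpow_one 2
  calc r ^ γ * s ^ k = r ^ (γ - θ) * (r ^ θ * s ^ θ) * s ^ (k - θ) := by rw [e1, e2]; ring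
    _ ≤ (2 ^ (γ - θ) * a ^ (γ - θ) * b ^ (γ - θ)) * (2 ^ θ * d ^ θ * b ^ θ) * s ^ (k - 1) := by
        gcongr
    _ = (2 ^ (γ - θ) * 2 ^ θ) * (s ^ (k - 1) * (a ^ (γ - θ) * b ^ γ * d ^ θ)) := by
        rw [e3]; ring
    _ ≤ _ := by gcongr

/-- In the cross terms one power of the larger bracket is left to spare, which pays for
`r^γ ≤ 2ab`. -/
theorem rpow_mul_cross_le {r s c a b γ k : ℝ} (hr : 0 ≤ r) (hs : 0 ≤ s) (hc : 0 ≤ c)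
    (hc1 : c ≤ 1) (ha : 1 ≤ a) (hb : 1 ≤ b) (hrab : r ≤ 2 * a * b)
    (hγ0 : 0 ≤ γ) (hγ : γ ≤ 1) :
    r ^ γ * ((s * a) ^ (k - 1) * (c * b)) ≤ 2 * (s ^ (k - 1) * (a ^ k * b ^ (2 : ℝ))) := by
  have ha0 : 0 < a := by linarith
  have hb0 : 0 < b := by linarith
  have h1 : r ^ γ ≤ 2 * a * b := by
    calc r ^ γ ≤ (2 * a * b) ^ γ := Real.rpow_le_rpow hr hrab hγ0
      _ ≤ (2 * a * b) ^ (1 : ℝ) := Real.rpow_le_rpow_of_exponent_le (by nlinarith) hγ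
      _ = _ := Real.rpow_one _
  have e : a ^ k = a ^ (k - 1) * a := by
    rw [← Real.rpow_add_one ha0.ne']; congr 1; ring
  calc r ^ γ * ((s * a) ^ (k - 1) * (c * b))
      ≤ (2 * a * b) * ((s * a) ^ (k - 1) * (1 * b)) := by gcongr
    _ = _ := by rw [Real.mul_rpow hs ha0.le, e, Real.rpow_two]; ring

/-- The pointwise bound of the weight `|v - v_*|^γ ⟨v'⟩^k` behind the gain-term estimate. In the
principal terms the whole weight `⟨·⟩^k` falls on one velocity, and the coefficient does not depend
on `k`; in the remaining terms no velocity carries more than the weight `⟨·⟩^k`. -/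
theorem norm_rpow_mul_jap_vPrime_rpow_le {γ θ k : ℝ} (hθ : 0 ≤ θ) (hθγ : θ ≤ γ) (hγ : γ ≤ 1)
    (hk : 2 ≤ k) {v vs : V} (h : v ≠ vs) (σ : S2) :
    ‖v - vs‖ ^ γ * jap (vPrime v vs σ) ^ k ≤
      2 * (halfCos σ (v - vs) ^ (k - 1) *
          (jap vs ^ γ * jap v ^ (k + γ - θ) * jap (vPrime v vs σ) ^ θ)) +
        2 * (halfCos σ (vs - v) ^ (k - 1) *
          (jap vs ^ (k + γ - θ) * jap v ^ γ * jap (vPrime v vs σ) ^ θ)) +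
      2 * crossConst k * (halfCos σ (v - vs) ^ (k - 1) * (jap vs ^ (2 : ℝ) * jap v ^ k)) +
      2 * crossConst k * (halfCos σ (vs - v) ^ (k - 1) * (jap vs ^ k * jap v ^ (2 : ℝ))) := by
  have hM := crossConst_nonneg (by linarith : 0 ≤ k)
  have hda := norm_sub_mul_halfCos v vs σ
  have hdb := norm_sub_mul_halfCos vs v σ
  rw [← vPrime_comm, norm_sub_rev] at hdb
  have hra := norm_sub_le_two_mul_jap v vs
  have hrb := norm_sub_le_two_mul_jap vs v
  rw [norm_sub_rev] at hrb
  have hd1 := norm_sub_le_two_mul_jap (vPrime v vs σ) vs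
  have hd2 := norm_sub_le_two_mul_jap (vPrime v vs σ) v
  rw [← hda] at hd1
  rw [← hdb] at hd2
  have hmain := jap_vPrime_le h σ
  have hr := norm_nonneg (v - vs)
  have hs := halfCos_nonneg σ (v - vs)
  have hc := halfCos_nonneg σ (vs - v)
  have hs1 := halfCos_le_one σ (v - vs)
  have hc1 := halfCos_le_one σ (vs - v)
  have ha := one_le_jap v
  have hb := one_le_jap vs
  have hd := one_le_jap (vPrime v vs σ)
  generalize ‖v - vs‖ = r at *
  generalize halfCos σ (v - vs) = s at *
  generalize halfCos σ (vs - v) = c at *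
  generalize jap v = a at *
  generalize jap vs = b at *
  generalize jap (vPrime v vs σ) = d at *
  have ha0 : 0 < a := by linarith
  have hb0 : 0 < b := by linarith
  have hd0 : 0 < d := by linarith
  have ea : a ^ (k + γ - θ) = a ^ (γ - θ) * a ^ k := by
    rw [← Real.rpow_add ha0]; congr 1; ring
  have eb : b ^ (k + γ - θ) = b ^ (γ - θ) * b ^ k := by
    rw [← Real.rpow_add hb0]; congr 1; ring
  have p1 := rpow_mul_rpow_le hr hs hs1 ha0.le hb0.le hd0.le hra hd1 hθ hθγ hγ hk
  have p2 := rpow_mul_rpow_le hr hc hc1 hb0.le ha0.le hd0.le hrb hd2 hθ hθγ hγ hk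
  have q1 := rpow_mul_cross_le (k := k) hr hs hc hc1 ha hb hra (hθ.trans hθγ) hγ
  have q2 := rpow_mul_cross_le (k := k) hr hc hs hs1 hb ha hrb (hθ.trans hθγ) hγ
  have p1' := mul_le_mul_of_nonneg_right p1 (Real.rpow_nonneg ha0.le k)
  have p2' := mul_le_mul_of_nonneg_right p2 (Real.rpow_nonneg hb0.le k)
  have q1' := mul_le_mul_of_nonneg_left q1 hM
  have q2' := mul_le_mul_of_nonneg_left q2 hM
  calc r ^ γ * d ^ k ≤ r ^ γ * (s * a + c * b) ^ k := by gcongr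
    _ ≤ r ^ γ * ((s * a) ^ k + (c * b) ^ k + crossConst k *
          ((s * a) ^ (k - 1) * (c * b) + (c * b) ^ (k - 1) * (s * a))) := by
        gcongr
        exact add_rpow_le (by positivity) (by positivity) (by linarith)
    _ = r ^ γ * s ^ k * a ^ k + r ^ γ * c ^ k * b ^ k +
          crossConst k * (r ^ γ * ((s * a) ^ (k - 1) * (c * b))) +
          crossConst k * (r ^ γ * ((c * b) ^ (k - 1) * (s * a))) := by
        rw [Real.mul_rpow hs ha0.le, Real.mul_rpow hc hb0.le]; ring
    _ ≤ _ := by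
        rw [ea, eb]
        linarith

/-! ### Estimates of the gain and loss terms for nonnegative functions -/

/-- The weight `⟨v⟩^l` as an extended nonnegative real. -/
def jw (l : ℝ) (v : V) : ℝ≥0∞ := ENNReal.ofReal (jap v ^ l)

@[fun_prop]
theorem measurable_jw (l : ℝ) : Measurable (jw l) := by unfold jw; fun_prop

theorem jw_add (l m : ℝ) (v : V) : jw (l + m) v = jw l v * jw m v := by
  unfold jw
  rw [Real.rpow_add (jap_pos v), ENNReal.ofReal_mul (by have := jap_pos v; positivity)]

theorem jw_mono {l m : ℝ} (h : l ≤ m) (v : V) : jw l v ≤ jw m v :=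
  ENNReal.ofReal_le_ofReal (Real.rpow_le_rpow_of_exponent_le (one_le_jap v) h)

/-- The weighted `L¹` norm of a function with values in `[0, ∞]`. -/
def wl1 (l : ℝ) (F : V → ℝ≥0∞) : ℝ≥0∞ := ∫⁻ v, jw l v * F v

/-- The weighted `L²` norm of a function with values in `[0, ∞]`. -/
def wl2 (l : ℝ) (F : V → ℝ≥0∞) : ℝ≥0∞ := l2 fun v => jw l v * F v

theorem l2_mono {F G : V → ℝ≥0∞} (h : ∀ v, F v ≤ G v) : l2 F ≤ l2 G := by
  unfold l2
  gcongr with v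
  exact h v

theorem l2_jw_lt_top : l2 (jw (-6)) < ∞ := by
  unfold l2
  refine ENNReal.rpow_lt_top_of_nonneg (by norm_num) (ne_of_lt ?_)
  have h : Integrable fun v : V => (1 + ‖v‖ ^ 2) ^ (-(12 : ℝ) / 2) :=
    integrable_rpow_neg_one_add_norm_sq (by rw [finrank_euclideanSpace_fin]; norm_num)
  refine lt_of_le_of_lt (le_of_eq (lintegral_congr fun v => ?_)) h.lintegral_lt_top
  have h0 : 0 ≤ 1 + ‖v‖ ^ 2 := by positivity
  unfold jw jap
  rw [ENNReal.ofReal_rpow_of_nonneg (by positivity) (by norm_num), Real.sqrt_eq_rpow,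
    ← Real.rpow_mul h0, ← Real.rpow_mul h0]
  norm_num

/-- Cauchy–Schwarz against `⟨v⟩^{l - k} ≤ ⟨v⟩^{-6}`, which is square integrable on `ℝ³`. -/
theorem exists_wl1_le_wl2 : ∃ D : ℝ, 0 ≤ D ∧ ∀ l k : ℝ, l ≤ 2 → 8 ≤ k →
    ∀ F : V → ℝ≥0∞, Measurable F → wl1 l F ≤ ENNReal.ofReal D * wl2 k F := by
  refine ⟨(l2 (jw (-6))).toReal, ENNReal.toReal_nonneg, fun l k hl hk F hF => ?_⟩
  rw [ENNReal.ofReal_toReal l2_jw_lt_top.ne]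
  refine le_trans ?_ (lintegral_mul_le_l2_mul_l2 (measurable_jw (-6))
    ((measurable_jw k).mul hF))
  refine lintegral_mono fun v => ?_
  rw [← mul_assoc, ← jw_add]
  gcongr
  exact jw_mono (by linarith) v

instance : SFinite ((volume : Measure V).prod sphereMeasure) := Measure.prod.instSFinite

theorem lintegral_triple {K : V → V → S2 → ℝ≥0∞}
    (hK : Measurable fun z : V × V × S2 => K z.1 z.2.1 z.2.2) :
    ∫⁻ z, K z.1 z.2.1 z.2.2 ∂((volume : Measure V).prod
      ((volume : Measure V).prod sphereMeasure)) =
      ∫⁻ v, ∫⁻ vs, ∫⁻ σ, K v vs σ ∂sphereMeasure := by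
  rw [lintegral_prod _ hK.aemeasurable]
  refine lintegral_congr fun v => ?_
  rw [lintegral_prod]
  exact (hK.comp measurable_prodMk_left).aemeasurable

theorem lintegral_triple_add {K L : V → V → S2 → ℝ≥0∞}
    (hK : Measurable fun z : V × V × S2 => K z.1 z.2.1 z.2.2)
    (hL : Measurable fun z : V × V × S2 => L z.1 z.2.1 z.2.2) :
    ∫⁻ v, ∫⁻ vs, ∫⁻ σ, (K v vs σ + L v vs σ) ∂sphereMeasure =
      (∫⁻ v, ∫⁻ vs, ∫⁻ σ, K v vs σ ∂sphereMeasure) +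
        ∫⁻ v, ∫⁻ vs, ∫⁻ σ, L v vs σ ∂sphereMeasure := by
  rw [← lintegral_triple hK, ← lintegral_triple hL, ← lintegral_add_left hK,
    ← lintegral_triple (K := fun v vs σ => K v vs σ + L v vs σ) (hK.add hL)]

theorem lintegral_triple_const_mul {K : V → V → S2 → ℝ≥0∞}
    (hK : Measurable fun z : V × V × S2 => K z.1 z.2.1 z.2.2) (c : ℝ≥0∞) :
    ∫⁻ v, ∫⁻ vs, ∫⁻ σ, c * K v vs σ ∂sphereMeasure =
      c * ∫⁻ v, ∫⁻ vs, ∫⁻ σ, K v vs σ ∂sphereMeasure := by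
  rw [← lintegral_triple hK, ← lintegral_const_mul _ hK,
    ← lintegral_triple (K := fun v vs σ => c * K v vs σ) (hK.const_mul c)]

theorem ofReal_norm_rpow_mul_jw_vPrime_le {γ θ k : ℝ} (hθ : 0 ≤ θ) (hθγ : θ ≤ γ) (hγ : γ ≤ 1)
    (hk : 2 ≤ k) {v vs : V} (h : v ≠ vs) (σ : S2) :
    ENNReal.ofReal (‖v - vs‖ ^ γ) * jw k (vPrime v vs σ) ≤
      (ENNReal.ofReal 2 * (ENNReal.ofReal (halfCos σ (v - vs) ^ (k - 1)) *
          (jw γ vs * jw (k + γ - θ) v * jw θ (vPrime v vs σ))) +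
        ENNReal.ofReal 2 * (ENNReal.ofReal (halfCos σ (vs - v) ^ (k - 1)) *
          (jw (k + γ - θ) vs * jw γ v * jw θ (vPrime v vs σ)))) +
      (ENNReal.ofReal (2 * crossConst k) * (ENNReal.ofReal (halfCos σ (v - vs) ^ (k - 1)) *
          (jw 2 vs * jw k v)) +
        ENNReal.ofReal (2 * crossConst k) * (ENNReal.ofReal (halfCos σ (vs - v) ^ (k - 1)) *
          (jw k vs * jw 2 v))) := by
  have hM := crossConst_nonneg (by linarith : 0 ≤ k)
  have hs := halfCos_nonneg σ (v - vs)
  have hc := halfCos_nonneg σ (vs - v)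
  have ha := jap_pos v
  have hb := jap_pos vs
  have hd := jap_pos (vPrime v vs σ)
  have hmain := norm_rpow_mul_jap_vPrime_rpow_le hθ hθγ hγ hk h σ
  unfold jw
  simp (disch := positivity) only [← ENNReal.ofReal_mul, ← ENNReal.ofReal_add]
  refine ENNReal.ofReal_le_ofReal (hmain.trans_eq ?_)
  ring

theorem const_div_sqrt_sub_one_le {C k : ℝ} (hC : 0 ≤ C) (hk : 2 ≤ k) :
    C / Real.sqrt (k - 1) ≤ 2 * C / Real.sqrt k := by
  have h1 : Real.sqrt k ≤ 2 * Real.sqrt (k - 1) := by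
    rw [Real.sqrt_le_left (by positivity), mul_pow, Real.sq_sqrt (by linarith)]
    linarith
  have h2 : 0 < Real.sqrt (k - 1) := Real.sqrt_pos.2 (by linarith)
  have h3 : 0 < Real.sqrt k := Real.sqrt_pos.2 (by linarith)
  rw [div_le_div_iff₀ h2 h3]
  nlinarith

/-- The gain term after the collisional change of variables. The parameter `θ` says how much of the
kinetic weight is carried by `H`: the value `γ / 2` serves the pairing and `0` the norm estimate. -/
theorem exists_gain_bound : ∃ A : ℝ, 0 < A ∧ ∃ B : ℝ → ℝ, (∀ k, 0 ≤ B k) ∧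
    ∀ γ θ k : ℝ, 0 ≤ θ → θ ≤ γ → γ ≤ 1 → 8 ≤ k →
    ∀ F G H : V → ℝ≥0∞, Measurable F → Measurable G → Measurable H →
      ∫⁻ v : V, ∫⁻ vs : V, ∫⁻ σ : S2, ENNReal.ofReal (‖v - vs‖ ^ γ) *
          (F vs * G v * (jw k (vPrime v vs σ) * H (vPrime v vs σ))) ∂sphereMeasure
        ≤ ENNReal.ofReal (A / Real.sqrt k) * (wl1 γ F * wl2 (k + γ - θ) G * wl2 θ H) +
          ENNReal.ofReal (A / Real.sqrt k) * (wl1 γ G * wl2 (k + γ - θ) F * wl2 θ H) +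
          ENNReal.ofReal (B k) * (wl2 k F * wl2 k G * l2 H) := by
  obtain ⟨C, hC, hT⟩ := exists_trilinear_bound_symm
  obtain ⟨D, hD, hL⟩ := exists_wl1_le_wl2
  refine ⟨4 * C, by positivity, fun k => |8 * C * D * crossConst k|, fun k => abs_nonneg _,
    fun γ θ k hθ hθγ hγ hk F G H hF hG hH => ?_⟩
  have hM := crossConst_nonneg (by linarith : 0 ≤ k)
  have hFw : ∀ l, Measurable fun v => jw l v * F v := fun l => by fun_prop
  have hGw : ∀ l, Measurable fun v => jw l v * G v := fun l => by fun_prop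
  have hHw : ∀ l, Measurable fun v => jw l v * H v := fun l => by fun_prop
  have t1 := (hT (k - 1) (by linarith) _ _ _ (hFw γ) (hGw (k + γ - θ)) (hHw θ)).1
  have t2 := (hT (k - 1) (by linarith) _ _ _ (hGw γ) (hFw (k + γ - θ)) (hHw θ)).2
  have t3 := (hT (k - 1) (by linarith) _ _ _ (hFw 2) (hGw k) hH).1
  have t4 := (hT (k - 1) (by linarith) _ _ _ (hGw 2) (hFw k) hH).2
  have hconst : ENNReal.ofReal (C / Real.sqrt (k - 1)) ≤ ENNReal.ofReal (2 * C / Real.sqrt k) :=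
    ENNReal.ofReal_le_ofReal (const_div_sqrt_sub_one_le hC.le (by linarith))
  have hconst' : ENNReal.ofReal (C / Real.sqrt (k - 1)) ≤ ENNReal.ofReal (2 * C) := by
    refine hconst.trans (ENNReal.ofReal_le_ofReal (div_le_self (by positivity) ?_))
    exact Real.one_le_sqrt.2 (by linarith)
  calc _ ≤ ∫⁻ v : V, ∫⁻ vs : V, ∫⁻ σ : S2,
        ((2 * (ENNReal.ofReal (halfCos σ (v - vs) ^ (k - 1)) * ((jw γ vs * F vs) *
            (jw (k + γ - θ) v * G v) * (jw θ (vPrime v vs σ) * H (vPrime v vs σ)))) +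
          2 * (ENNReal.ofReal (halfCos σ (vs - v) ^ (k - 1)) * ((jw (k + γ - θ) vs * F vs) *
            (jw γ v * G v) * (jw θ (vPrime v vs σ) * H (vPrime v vs σ))))) +
        (ENNReal.ofReal (2 * crossConst k) * (ENNReal.ofReal (halfCos σ (v - vs) ^ (k - 1)) *
            ((jw 2 vs * F vs) * (jw k v * G v) * H (vPrime v vs σ))) +
          ENNReal.ofReal (2 * crossConst k) * (ENNReal.ofReal (halfCos σ (vs - v) ^ (k - 1)) *
            ((jw k vs * F vs) * (jw 2 v * G v) * H (vPrime v vs σ))))) ∂sphereMeasure := by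
        refine lintegral_mono fun v => lintegral_mono_ae ?_
        filter_upwards [Measure.ae_ne volume v] with vs hvs
        refine lintegral_mono fun σ => ?_
        have h := ofReal_norm_rpow_mul_jw_vPrime_le (k := k) hθ hθγ hγ (by linarith) hvs.symm σ
        rw [ENNReal.ofReal_ofNat] at h
        have h' := mul_le_mul_left h (F vs * G v * H (vPrime v vs σ))
        refine le_trans (le_of_eq ?_) (h'.trans_eq ?_) <;> ring
    _ = 2 * (∫⁻ v : V, ∫⁻ vs : V, ∫⁻ σ : S2, ENNReal.ofReal (halfCos σ (v - vs) ^ (k - 1)) *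
            ((jw γ vs * F vs) * (jw (k + γ - θ) v * G v) *
              (jw θ (vPrime v vs σ) * H (vPrime v vs σ))) ∂sphereMeasure) +
          2 * (∫⁻ v : V, ∫⁻ vs : V, ∫⁻ σ : S2, ENNReal.ofReal (halfCos σ (vs - v) ^ (k - 1)) *
            ((jw (k + γ - θ) vs * F vs) * (jw γ v * G v) *
              (jw θ (vPrime v vs σ) * H (vPrime v vs σ))) ∂sphereMeasure) +
        (ENNReal.ofReal (2 * crossConst k) * (∫⁻ v : V, ∫⁻ vs : V, ∫⁻ σ : S2,
            ENNReal.ofReal (halfCos σ (v - vs) ^ (k - 1)) *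
            ((jw 2 vs * F vs) * (jw k v * G v) * H (vPrime v vs σ)) ∂sphereMeasure) +
          ENNReal.ofReal (2 * crossConst k) * (∫⁻ v : V, ∫⁻ vs : V, ∫⁻ σ : S2,
            ENNReal.ofReal (halfCos σ (vs - v) ^ (k - 1)) *
            ((jw k vs * F vs) * (jw 2 v * G v) * H (vPrime v vs σ)) ∂sphereMeasure)) := by
        rw [lintegral_triple_add (by fun_prop) (by fun_prop),
          lintegral_triple_add (by fun_prop) (by fun_prop),
          lintegral_triple_add (by fun_prop) (by fun_prop),
          lintegral_triple_const_mul (by fun_prop), lintegral_triple_const_mul (by fun_prop),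
          lintegral_triple_const_mul (by fun_prop), lintegral_triple_const_mul (by fun_prop)]
    _ ≤ 2 * (ENNReal.ofReal (2 * C / Real.sqrt k) * (wl1 γ F * wl2 (k + γ - θ) G * wl2 θ H)) +
          2 * (ENNReal.ofReal (2 * C / Real.sqrt k) * (wl1 γ G * wl2 (k + γ - θ) F * wl2 θ H)) +
        (ENNReal.ofReal (2 * crossConst k) * (ENNReal.ofReal (2 * C) *
            ((ENNReal.ofReal D * wl2 k F) * wl2 k G * l2 H)) +
          ENNReal.ofReal (2 * crossConst k) * (ENNReal.ofReal (2 * C) *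
            ((ENNReal.ofReal D * wl2 k G) * wl2 k F * l2 H))) := by
        gcongr
        · exact t1.trans (mul_le_mul_left hconst _)
        · exact t2.trans (mul_le_mul_left hconst _)
        · exact t3.trans (mul_le_mul' hconst' (mul_le_mul' (mul_le_mul' (hL 2 k le_rfl hk F hF) le_rfl) le_rfl))
        · exact t4.trans (mul_le_mul' hconst' (mul_le_mul' (mul_le_mul' (hL 2 k le_rfl hk G hG) le_rfl) le_rfl))
    _ = _ := by
        have e1 : ENNReal.ofReal (4 * C / Real.sqrt k) =
            2 * ENNReal.ofReal (2 * C / Real.sqrt k) := by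
          rw [show (2 : ℝ≥0∞) = ENNReal.ofReal 2 by simp, ← ENNReal.ofReal_mul zero_le_two]
          congr 1; ring
        have e2 : ENNReal.ofReal |8 * C * D * crossConst k| = 2 * (ENNReal.ofReal (2 * crossConst k)
            * (ENNReal.ofReal (2 * C) * ENNReal.ofReal D)) := by
          rw [show (2 : ℝ≥0∞) = ENNReal.ofReal 2 by simp, ← ENNReal.ofReal_mul (by positivity),
            ← ENNReal.ofReal_mul (by positivity), ← ENNReal.ofReal_mul (by positivity),
            abs_of_nonneg (by positivity)]
          congr 1; ring
        rw [e1, e2]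
        ring

theorem exists_loss_bound : ∃ A : ℝ, 0 < A ∧
    ∀ γ θ k : ℝ, 0 ≤ γ → γ ≤ 1 →
    ∀ F G H : V → ℝ≥0∞, Measurable F → Measurable G → Measurable H →
      ∫⁻ v : V, ∫⁻ vs : V, ∫⁻ _ : S2, ENNReal.ofReal (‖v - vs‖ ^ γ) *
          (F vs * G v * (jw k v * H v)) ∂sphereMeasure
        ≤ ENNReal.ofReal A * (wl1 γ F * wl2 (k + γ - θ) G * wl2 θ H) := by
  set m : ℝ := sphereMeasure.real Set.univ with hm
  have hmE : sphereMeasure Set.univ = ENNReal.ofReal m := by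
    rw [hm, ofReal_measureReal]
  have hm0 : 0 ≤ m := measureReal_nonneg
  refine ⟨2 * m + 1, by positivity, fun γ θ k hγ0 hγ F G H hF hG hH => ?_⟩
  have hpt : ∀ v vs : V, ENNReal.ofReal (‖v - vs‖ ^ γ) ≤ ENNReal.ofReal 2 * (jw γ v * jw γ vs) := by
    intro v vs
    have ha := jap_pos v
    have hb := jap_pos vs
    unfold jw
    rw [← ENNReal.ofReal_mul (by positivity), ← ENNReal.ofReal_mul (by positivity)]
    refine ENNReal.ofReal_le_ofReal ?_
    calc ‖v - vs‖ ^ γ ≤ (2 * jap v * jap vs) ^ γ :=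
          Real.rpow_le_rpow (norm_nonneg _) (norm_sub_le_two_mul_jap v vs) hγ0
      _ = 2 ^ γ * (jap v ^ γ * jap vs ^ γ) := by
          rw [Real.mul_rpow (by positivity) hb.le, Real.mul_rpow (by norm_num) ha.le, mul_assoc]
      _ ≤ 2 ^ (1 : ℝ) * (jap v ^ γ * jap vs ^ γ) := by
          gcongr
          norm_num
      _ = _ := by rw [Real.rpow_one]
  calc _ ≤ ∫⁻ v : V, ∫⁻ vs : V, ENNReal.ofReal (2 * m) *
            ((jw γ vs * F vs) * ((jw (k + γ - θ) v * G v) * (jw θ v * H v))) := by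
        refine lintegral_mono fun v => lintegral_mono fun vs => ?_
        rw [lintegral_const, hmE, ENNReal.ofReal_mul zero_le_two]
        have e : jw (k + γ - θ) v * jw θ v = jw γ v * jw k v := by
          rw [← jw_add, ← jw_add]; congr 1; ring
        have h := mul_le_mul_left (hpt v vs) (F vs * G v * (jw k v * H v) * ENNReal.ofReal m)
        refine le_trans (le_of_eq ?_) (h.trans_eq ?_)
        · ring
        · calc _ = ENNReal.ofReal 2 * ENNReal.ofReal m * (jw γ vs * F vs) * (jw γ v * jw k v) * (G v * H v) := by
                ring
            _ = _ := by rw [← e]; ring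
    _ = ENNReal.ofReal (2 * m) * (wl1 γ F *
          ∫⁻ v : V, (jw (k + γ - θ) v * G v) * (jw θ v * H v)) := by
        unfold wl1
        rw [← lintegral_const_mul _ (by fun_prop), ← lintegral_const_mul _ (by fun_prop)]
        refine lintegral_congr fun v => ?_
        rw [lintegral_const_mul _ (by fun_prop), lintegral_mul_const _ (by fun_prop)]
    _ ≤ _ := by
        rw [mul_assoc (wl1 γ F)]
        gcongr
        · linarith
        · exact lintegral_mul_le_l2_mul_l2 (by fun_prop) (by fun_prop)

/-- The integral over `(v_*, σ)` of the sum of the absolute values of the two parts of the collision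
integrand. -/
def absCollision (γ : ℝ) (F G : V → ℝ≥0∞) (v : V) : ℝ≥0∞ :=
  ∫⁻ vs, ∫⁻ σ, ENNReal.ofReal (‖v - vs‖ ^ γ) *
    (F (vsPrime v vs σ) * G (vPrime v vs σ) + F vs * G v) ∂sphereMeasure

theorem measurable_absCollision (γ : ℝ) {F G : V → ℝ≥0∞} (hF : Measurable F) (hG : Measurable G) :
    Measurable (absCollision γ F G) := by
  unfold absCollision
  have h : Measurable fun z : (V × V) × S2 => ENNReal.ofReal (‖z.1.1 - z.1.2‖ ^ γ) *
      (F (vsPrime z.1.1 z.1.2 z.2) * G (vPrime z.1.1 z.1.2 z.2) + F z.1.2 * G z.1.1) := by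
    fun_prop
  have h' : Measurable fun z : V × V => ∫⁻ σ, ENNReal.ofReal (‖z.1 - z.2‖ ^ γ) *
      (F (vsPrime z.1 z.2 σ) * G (vPrime z.1 z.2 σ) + F z.2 * G z.1) ∂sphereMeasure :=
    h.lintegral_prod_right'
  exact h'.lintegral_prod_right'

theorem norm_vPrime_sub_vsPrime (v vs : V) (σ : S2) :
    ‖vPrime v vs σ - vsPrime v vs σ‖ = ‖v - vs‖ := by
  have : vPrime v vs σ - vsPrime v vs σ = ‖v - vs‖ • (σ : V) := by
    unfold vPrime vsPrime; module
  rw [this, norm_smul]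
  simp

theorem exists_absCollision_bound : ∃ A : ℝ, 0 < A ∧ ∃ A' : ℝ, 0 < A' ∧
    ∃ B : ℝ → ℝ, (∀ k, 0 < B k) ∧ ∀ γ θ k : ℝ, 0 ≤ θ → θ ≤ γ → γ ≤ 1 → 8 ≤ k →
    ∀ F G H : V → ℝ≥0∞, Measurable F → Measurable G → Measurable H →
      ∫⁻ v : V, absCollision γ F G v * (jw k v * H v)
        ≤ ENNReal.ofReal (A / Real.sqrt k) * (wl1 γ G * wl2 (k + γ - θ) F * wl2 θ H) +
          ENNReal.ofReal A' * (wl1 γ F * wl2 (k + γ - θ) G * wl2 θ H) +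
          ENNReal.ofReal (B k) * (wl2 k F * wl2 k G * l2 H) := by
  obtain ⟨A, hA, B, hB, hg⟩ := exists_gain_bound
  obtain ⟨A', hA', hl⟩ := exists_loss_bound
  refine ⟨A, hA, A + A', by positivity, fun k => B k + 1, fun k => by linarith [hB k],
    fun γ θ k hθ hθγ hγ hk F G H hF hG hH => ?_⟩
  have h1 := hg γ θ k hθ hθγ hγ hk F G H hF hG hH
  have h2 := hl γ θ k (hθ.trans hθγ) hγ F G H hF hG hH
  have hAk : A / Real.sqrt k ≤ A :=
    div_le_self hA.le (Real.one_le_sqrt.2 (by linarith))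
  have hswap := lintegral_collision_swap (fun v vs w ws => ENNReal.ofReal (‖v - vs‖ ^ γ) *
    (F ws * G w * (jw k v * H v))) (by fun_prop)
  simp only [norm_vPrime_sub_vsPrime] at hswap
  calc ∫⁻ v : V, absCollision γ F G v * (jw k v * H v)
      = ∫⁻ v : V, ∫⁻ vs : V, ∫⁻ σ : S2, (ENNReal.ofReal (‖v - vs‖ ^ γ) *
          (F (vsPrime v vs σ) * G (vPrime v vs σ) * (jw k v * H v)) +
          ENNReal.ofReal (‖v - vs‖ ^ γ) * (F vs * G v * (jw k v * H v))) ∂sphereMeasure := by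
        refine lintegral_congr fun v => ?_
        unfold absCollision
        have h : Measurable fun z : V × S2 => ENNReal.ofReal (‖v - z.1‖ ^ γ) *
            (F (vsPrime v z.1 z.2) * G (vPrime v z.1 z.2) + F z.1 * G v) := by fun_prop
        rw [← lintegral_mul_const _ (by exact h.lintegral_prod_right')]
        refine lintegral_congr fun vs => ?_
        rw [← lintegral_mul_const _ (by fun_prop)]
        refine lintegral_congr fun σ => ?_
        ring
    _ ≤ (ENNReal.ofReal (A / Real.sqrt k) * (wl1 γ F * wl2 (k + γ - θ) G * wl2 θ H) +
          ENNReal.ofReal (A / Real.sqrt k) * (wl1 γ G * wl2 (k + γ - θ) F * wl2 θ H) +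
          ENNReal.ofReal (B k) * (wl2 k F * wl2 k G * l2 H)) +
          ENNReal.ofReal A' * (wl1 γ F * wl2 (k + γ - θ) G * wl2 θ H) := by
        rw [lintegral_triple_add (by fun_prop) (by fun_prop), hswap]
        exact add_le_add h1 h2
    _ ≤ (ENNReal.ofReal A * (wl1 γ F * wl2 (k + γ - θ) G * wl2 θ H) +
          ENNReal.ofReal (A / Real.sqrt k) * (wl1 γ G * wl2 (k + γ - θ) F * wl2 θ H) +
          ENNReal.ofReal (B k + 1) * (wl2 k F * wl2 k G * l2 H)) +
          ENNReal.ofReal A' * (wl1 γ F * wl2 (k + γ - θ) G * wl2 θ H) := by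
        gcongr
        linarith
    _ = _ := by
        rw [ENNReal.ofReal_add hA.le hA'.le]
        ring

/-! ### Duality in `L²` -/

theorem rpow_half_le_of_le_mul {X M : ℝ≥0∞} (hX : X ≠ ∞) (h : X ≤ M * X ^ (1 / 2 : ℝ)) :
    X ^ (1 / 2 : ℝ) ≤ M := by
  by_cases h0 : X = 0
  · simp [h0]
  have hne : X ^ (1 / 2 : ℝ) ≠ 0 := by simp [h0, hX]
  have hnt : X ^ (1 / 2 : ℝ) ≠ ∞ := ENNReal.rpow_ne_top_of_nonneg (by norm_num) hX
  have hsq : X ^ (1 / 2 : ℝ) * X ^ (1 / 2 : ℝ) = X := by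
    rw [← ENNReal.rpow_add _ _ h0 hX]; norm_num
  refine (ENNReal.mul_le_mul_iff_left hne hnt).1 ?_
  rwa [hsq]

theorem l2_le_of_forall_lintegral_mul_le {T : V → ℝ≥0∞} (hT : Measurable T) {M : ℝ≥0∞}
    (h : ∀ H : V → ℝ≥0∞, Measurable H → ∫⁻ v, T v * H v ≤ M * l2 H) : l2 T ≤ M := by
  -- test against the truncations of `T`, which have finite `L²` norm
  set H : ℕ → V → ℝ≥0∞ := fun n => (Metric.ball (0 : V) n).indicator fun v => min (T v) n with hH
  have hHm : ∀ n, Measurable (H n) := fun n =>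
    (hT.min measurable_const).indicator measurableSet_ball
  have hHT : ∀ n v, H n v ≤ T v := fun n v =>
    Set.indicator_le' (fun v _ => min_le_left _ _) (fun _ _ => zero_le) v
  have hfin : ∀ n, ∫⁻ v, H n v ^ (2 : ℝ) ≠ ∞ := by
    intro n
    refine ne_of_lt (lt_of_le_of_lt (b := ∫⁻ v in Metric.ball (0 : V) n, (n : ℝ≥0∞) ^ (2 : ℝ)) ?_ ?_)
    · rw [← lintegral_indicator measurableSet_ball]
      refine lintegral_mono fun v => ?_
      by_cases hv : v ∈ Metric.ball (0 : V) n
      · simp only [hH, Set.indicator_of_mem hv]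
        gcongr
        exact min_le_right _ _
      · simp [hH, Set.indicator_of_notMem hv]
    · rw [setLIntegral_const]
      exact ENNReal.mul_lt_top (by simp) measure_ball_lt_top
  have hle : ∀ n, (∫⁻ v, H n v ^ (2 : ℝ)) ^ (1 / 2 : ℝ) ≤ M := by
    intro n
    refine rpow_half_le_of_le_mul (hfin n) (le_trans ?_ (h (H n) (hHm n)))
    refine lintegral_mono fun v => ?_
    simp only [ENNReal.rpow_two, sq]
    gcongr
    exact hHT n v
  have hlim : Filter.Tendsto (fun n => ∫⁻ v, H n v ^ (2 : ℝ)) Filter.atTop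
      (nhds (∫⁻ v, T v ^ (2 : ℝ))) := by
    refine lintegral_tendsto_of_tendsto_of_monotone
      (fun n => ((hHm n).pow_const _).aemeasurable) (.of_forall fun v => ?_) (.of_forall fun v => ?_)
    · intro m n hmn
      refine ENNReal.rpow_le_rpow ?_ (by norm_num)
      have hc : (m : ℝ) ≤ n := by exact_mod_cast hmn
      refine (Set.indicator_le_indicator_of_subset (Metric.ball_subset_ball hc)
        (fun _ => zero_le) v).trans (Set.indicator_le_indicator ?_)
      gcongr
    · refine (ENNReal.continuous_rpow_const.tendsto _).comp ?_
      have h1 : Filter.Tendsto (fun n : ℕ => min (T v) (n : ℝ≥0∞)) Filter.atTop (nhds (T v)) := by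
        have := (tendsto_const_nhds (x := T v)).min ENNReal.tendsto_nat_nhds_top
        rwa [min_eq_left le_top] at this
      refine h1.congr' ?_
      obtain ⟨N, hN⟩ := exists_nat_gt ‖v‖
      filter_upwards [Filter.eventually_ge_atTop N] with n hn
      have hv : v ∈ Metric.ball (0 : V) n := by
        rw [mem_ball_zero_iff]
        exact hN.trans_le (by exact_mod_cast hn)
      simp only [hH, Set.indicator_of_mem hv]
  exact le_of_tendsto ((ENNReal.continuous_rpow_const.tendsto _).comp hlim) (.of_forall hle)

/-! ### The collision operator and null sets -/

/-- A property that holds almost everywhere holds at `v'` and at `v'_*` for almost every collision,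
by the collisional change of variables applied to the indicator of a null set. -/
theorem ae_ae_vPrime {P : V → Prop} (hP : ∀ᵐ w, P w) :
    ∀ᵐ v : V, ∀ᵐ p : V × S2 ∂((volume : Measure V).prod sphereMeasure),
      P (vPrime v p.1 p.2) ∧ P (vsPrime v p.1 p.2) := by
  obtain ⟨N, hPN, hNm, hN⟩ := exists_measurable_superset_of_null (ae_iff.1 hP)
  have hN' : ∀ᵐ w : V, w ∉ N := measure_eq_zero_iff_ae_notMem.1 hN
  have hind : Measurable (N.indicator (1 : V → ℝ≥0∞)) := measurable_one.indicator hNm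
  have h1 : ∫⁻ v, ∫⁻ vs, ∫⁻ σ, (N.indicator 1 (vPrime v vs σ) +
      N.indicator 1 (vsPrime v vs σ) : ℝ≥0∞) ∂sphereMeasure = 0 := by
    rw [lintegral_collision_swap (fun _ _ w ws => N.indicator 1 w + N.indicator 1 ws)
      (by fun_prop), lintegral_triple_add (by fun_prop) (by fun_prop), add_eq_zero]
    constructor
    · rw [lintegral_eq_zero_iff' (by fun_prop)]
      filter_upwards [hN'] with v hv
      simp [hv]
    · have : ∫⁻ vs, ∫⁻ _ : S2, N.indicator (1 : V → ℝ≥0∞) vs ∂sphereMeasure = 0 := by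
        rw [lintegral_eq_zero_iff' (by fun_prop)]
        filter_upwards [hN'] with v hv
        simp [hv]
      simp only [this, lintegral_zero]
  rw [← lintegral_triple (K := fun v vs σ => N.indicator 1 (vPrime v vs σ) +
    N.indicator 1 (vsPrime v vs σ)) (by fun_prop), lintegral_eq_zero_iff' (by fun_prop)] at h1
  filter_upwards [Measure.ae_ae_of_ae_prod h1] with v hv
  filter_upwards [hv] with p hp
  simp only [Pi.zero_apply, add_eq_zero, Set.indicator_apply_eq_zero, Pi.one_apply, one_ne_zero,
    imp_false] at hp
  exact ⟨by_contra fun h => hp.1 (hPN h), by_contra fun h => hp.2 (hPN h)⟩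

theorem ae_collisionIntegrand_congr (γ : ℝ) {f f' g g' : V → ℝ} (hf : f =ᵐ[volume] f')
    (hg : g =ᵐ[volume] g') :
    ∀ᵐ v : V, (fun p : V × S2 => collisionIntegrand γ f g v p.1 p.2)
      =ᵐ[(volume : Measure V).prod sphereMeasure]
        fun p => collisionIntegrand γ f' g' v p.1 p.2 := by
  have hf2 : ∀ᵐ p : V × S2 ∂((volume : Measure V).prod sphereMeasure), f p.1 = f' p.1 :=
    Measure.quasiMeasurePreserving_fst.ae hf
  filter_upwards [ae_ae_vPrime hf, ae_ae_vPrime hg, hg] with v h1 h2 h3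
  filter_upwards [h1, h2, hf2] with p h4 h5 h6
  unfold collisionIntegrand
  rw [h4.2, h5.1, h3, h6]

theorem Q_congr_ae (γ : ℝ) {f f' g g' : V → ℝ} (hf : f =ᵐ[volume] f') (hg : g =ᵐ[volume] g') :
    Q γ f g =ᵐ[volume] Q γ f' g' := by
  filter_upwards [ae_collisionIntegrand_congr γ hf hg] with v hv
  refine integral_congr_ae ?_
  filter_upwards [Measure.ae_ae_of_ae_prod hv] with vs hvs
  exact integral_congr_ae hvs

@[fun_prop]
theorem measurable_collisionIntegrand {α : Type*} [MeasurableSpace α] {γ : ℝ} {f g : V → ℝ}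
    {a b : α → V} {τ : α → S2} (hf : Measurable f) (hg : Measurable g) (ha : Measurable a)
    (hb : Measurable b) (hτ : Measurable τ) :
    Measurable fun x => collisionIntegrand γ f g (a x) (b x) (τ x) := by
  unfold collisionIntegrand
  fun_prop

theorem stronglyMeasurable_Q (γ : ℝ) {f g : V → ℝ} (hf : Measurable f) (hg : Measurable g) :
    StronglyMeasurable (Q γ f g) := by
  have h : StronglyMeasurable fun z : (V × V) × S2 => collisionIntegrand γ f g z.1.1 z.1.2 z.2 :=
    Measurable.stronglyMeasurable (by fun_prop)
  have h' : StronglyMeasurable fun z : V × V =>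
      ∫ σ, collisionIntegrand γ f g z.1 z.2 σ ∂sphereMeasure := h.integral_prod_right'
  exact h'.integral_prod_right'

theorem enorm_collisionIntegrand_le (γ : ℝ) (f g : V → ℝ) (v vs : V) (σ : S2) :
    ‖collisionIntegrand γ f g v vs σ‖ₑ ≤ ENNReal.ofReal (‖v - vs‖ ^ γ) *
      (‖f (vsPrime v vs σ)‖ₑ * ‖g (vPrime v vs σ)‖ₑ + ‖f vs‖ₑ * ‖g v‖ₑ) := by
  unfold collisionIntegrand
  rw [enorm_mul, Real.enorm_of_nonneg (by positivity), ← enorm_mul, ← enorm_mul]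
  gcongr
  exact enorm_sub_le

theorem enorm_Q_le (γ : ℝ) (f g : V → ℝ) (v : V) :
    ‖Q γ f g v‖ₑ ≤ absCollision γ (fun w => ‖f w‖ₑ) (fun w => ‖g w‖ₑ) v := by
  unfold Q absCollision
  refine (enorm_integral_le_lintegral_enorm _).trans (lintegral_mono fun vs => ?_)
  refine (enorm_integral_le_lintegral_enorm _).trans (lintegral_mono fun σ => ?_)
  exact enorm_collisionIntegrand_le γ f g v vs σ

theorem integrable_collisionIntegrand (γ : ℝ) {f g : V → ℝ} (hf : Measurable f)
    (hg : Measurable g) {v : V}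
    (h : absCollision γ (fun w => ‖f w‖ₑ) (fun w => ‖g w‖ₑ) v < ∞) :
    Integrable (fun p : V × S2 => collisionIntegrand γ f g v p.1 p.2)
      ((volume : Measure V).prod sphereMeasure) := by
  have hm : Measurable fun p : V × S2 => collisionIntegrand γ f g v p.1 p.2 :=
    by fun_prop
  refine ⟨hm.aestronglyMeasurable, lt_of_le_of_lt ?_ h⟩
  rw [lintegral_prod _ hm.enorm.aemeasurable]
  exact lintegral_mono fun vs => lintegral_mono fun σ => enorm_collisionIntegrand_le γ f g v vs σ

/-! ### Weighted norms -/

theorem enorm_jap_rpow_mul (l : ℝ) (f : V → ℝ) (v : V) :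
    ‖jap v ^ l * f v‖ₑ = jw l v * ‖f v‖ₑ := by
  rw [enorm_mul, Real.enorm_of_nonneg (Real.rpow_nonneg (jap_pos v).le l), jw]

theorem wl1_enorm (l : ℝ) (f : V → ℝ) :
    wl1 l (fun v => ‖f v‖ₑ) = eLpNorm (fun v => jap v ^ l * f v) 1 volume := by
  rw [eLpNorm_one_eq_lintegral_enorm]
  simp only [enorm_jap_rpow_mul, wl1]

theorem wl2_enorm (l : ℝ) (f : V → ℝ) :
    wl2 l (fun v => ‖f v‖ₑ) = eLpNorm (fun v => jap v ^ l * f v) 2 volume := by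
  rw [eLpNorm_eq_lintegral_rpow_enorm_toReal (by norm_num) (by norm_num)]
  simp only [enorm_jap_rpow_mul, wl2, l2, ENNReal.toReal_ofNat]

theorem wl2_mono {l m : ℝ} (h : l ≤ m) (F : V → ℝ≥0∞) : wl2 l F ≤ wl2 m F :=
  l2_mono fun v => mul_le_mul_left (jw_mono h v) _

theorem wl2_jw_mul (l m : ℝ) (F : V → ℝ≥0∞) : wl2 l (fun v => jw m v * F v) = wl2 (m + l) F := by
  unfold wl2
  simp only [← mul_assoc, ← jw_add, add_comm l m]

theorem wl2_zero (F : V → ℝ≥0∞) : wl2 0 F = l2 F := by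
  simp [wl2, jw]

theorem MemWLp.wl2_ne_top {l : ℝ} {f : V → ℝ} (hf : MemWLp 2 l f) :
    wl2 l (fun v => ‖f v‖ₑ) ≠ ∞ := by
  rw [wl2_enorm]; exact hf.2.ne

theorem MemWLp.exists_measurable {p : ℝ≥0∞} {l : ℝ} {f : V → ℝ} (hf : MemWLp p l f) :
    ∃ f' : V → ℝ, Measurable f' ∧ f =ᵐ[volume] f' := by
  have h : AEStronglyMeasurable f volume := by
    have h1 : AEStronglyMeasurable (fun v => jap v ^ (-l)) (volume : Measure V) := by
      have : Measurable fun v => jap v ^ (-l) := by fun_prop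
      exact this.aestronglyMeasurable
    refine (h1.mul hf.1).congr (.of_forall fun v => ?_)
    simp only [Pi.mul_apply]
    rw [← mul_assoc, ← Real.rpow_add (jap_pos v)]
    simp
  exact ⟨h.aemeasurable.mk f, h.aemeasurable.measurable_mk, h.aemeasurable.ae_eq_mk⟩

theorem ae_eq_weight {f f' : V → ℝ} (h : f =ᵐ[volume] f') (l : ℝ) :
    (fun v => jap v ^ l * f v) =ᵐ[volume] fun v => jap v ^ l * f' v := by
  filter_upwards [h] with v hv
  rw [hv]

theorem memWLp_congr_ae {f f' : V → ℝ} (h : f =ᵐ[volume] f') (p : ℝ≥0∞) (l : ℝ) :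
    MemWLp p l f ↔ MemWLp p l f' :=
  memLp_congr_ae (ae_eq_weight h l)

theorem wNorm_congr_ae {f f' : V → ℝ} (h : f =ᵐ[volume] f') (p : ℝ≥0∞) (l : ℝ) :
    wNorm p l f = wNorm p l f' := by
  unfold wNorm
  rw [eLpNorm_congr_ae (ae_eq_weight h l)]

theorem wNorm_nonneg (p : ℝ≥0∞) (l : ℝ) (f : V → ℝ) : 0 ≤ wNorm p l f := ENNReal.toReal_nonneg

theorem ofReal_wNorm_two {l : ℝ} {f : V → ℝ} (hf : wl2 l (fun v => ‖f v‖ₑ) ≠ ∞) :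
    ENNReal.ofReal (wNorm 2 l f) = wl2 l fun v => ‖f v‖ₑ := by
  rw [wl2_enorm] at hf ⊢
  exact ENNReal.ofReal_toReal hf

theorem ofReal_wNorm_one {l : ℝ} {f : V → ℝ} (hf : wl1 l (fun v => ‖f v‖ₑ) ≠ ∞) :
    ENNReal.ofReal (wNorm 1 l f) = wl1 l fun v => ‖f v‖ₑ := by
  rw [wl1_enorm] at hf ⊢
  exact ENNReal.ofReal_toReal hf

theorem wl1_ne_top {l m k : ℝ} (hl : l ≤ 2) (hk : 8 ≤ k) (hkm : k ≤ m) {f : V → ℝ}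
    (hf : Measurable f) (h : wl2 m (fun v => ‖f v‖ₑ) ≠ ∞) : wl1 l (fun v => ‖f v‖ₑ) ≠ ∞ := by
  obtain ⟨D, -, hD⟩ := exists_wl1_le_wl2
  exact ne_top_of_le_ne_top (ENNReal.mul_ne_top ENNReal.ofReal_ne_top h)
    (hD l m hl (hk.trans hkm) _ hf.enorm)

/-! ### Weighted estimates for the collision operator -/

/-- Absolute convergence of the collision integral, obtained by pairing with the positive function
`⟨v⟩^{k - 7}`. -/
theorem absCollision_ae_lt_top {γ k : ℝ} (hγ0 : 0 ≤ γ) (hγ : γ ≤ 1) (hk : 8 ≤ k) {f g : V → ℝ}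
    (hf : Measurable f) (hg : Measurable g) (hf2 : wl2 (k + γ / 2) (fun v => ‖f v‖ₑ) ≠ ∞)
    (hg2 : wl2 (k + γ / 2) (fun v => ‖g v‖ₑ) ≠ ∞) :
    ∀ᵐ v, absCollision γ (fun w => ‖f w‖ₑ) (fun w => ‖g w‖ₑ) v < ∞ := by
  obtain ⟨A, -, A', -, B, -, hmain⟩ := exists_absCollision_bound
  have h := hmain γ (γ / 2) k (by linarith) (by linarith) hγ hk _ _ (jw (-7)) hf.enorm hg.enorm
    (measurable_jw _)
  have e : k + γ - γ / 2 = k + γ / 2 := by ring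
  rw [e] at h
  have hf1 := wl1_ne_top (l := γ) (by linarith) hk (by linarith) hf hf2
  have hg1 := wl1_ne_top (l := γ) (by linarith) hk (by linarith) hg hg2
  have hfk := ne_top_of_le_ne_top hf2 (wl2_mono (by linarith : k ≤ k + γ / 2) _)
  have hgk := ne_top_of_le_ne_top hg2 (wl2_mono (by linarith : k ≤ k + γ / 2) _)
  have hH : wl2 (γ / 2) (jw (-7)) ≠ ∞ := by
    refine ne_top_of_le_ne_top l2_jw_lt_top.ne (l2_mono fun v => ?_)
    rw [← jw_add]
    exact jw_mono (by linarith) v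
  have hH' : l2 (jw (-7)) ≠ ∞ :=
    ne_top_of_le_ne_top l2_jw_lt_top.ne (l2_mono fun v => jw_mono (by norm_num) v)
  have hfin := ne_top_of_le_ne_top (by finiteness) h
  have hm := measurable_absCollision γ hf.enorm hg.enorm
  filter_upwards [ae_lt_top (by fun_prop) hfin] with v hv
  by_contra htop
  rw [not_lt_top_iff.1 htop, ENNReal.top_mul] at hv
  · exact lt_irrefl _ hv
  · rw [← jw_add]
    exact (ENNReal.ofReal_pos.2 (Real.rpow_pos_of_pos (jap_pos v) _)).ne'

theorem exists_weighted_pairing_bound : ∃ A : ℝ, 0 < A ∧ ∃ A' : ℝ, 0 < A' ∧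
    ∃ B : ℝ → ℝ, (∀ k, 0 < B k) ∧ ∀ γ k : ℝ, 0 ≤ γ → γ ≤ 1 → 8 ≤ k →
    (∀ f g h : V → ℝ, Measurable f → Measurable g → Measurable h →
      MemWLp 2 (k + γ / 2) f → MemWLp 2 (k + γ / 2) g → MemWLp 2 (k + γ / 2) h →
      Integrable (fun v => Q γ f g v * (h v * jap v ^ (2 * k))) ∧
      pairing (Q γ f g) (fun v => h v * jap v ^ (2 * k)) ≤
        A / Real.sqrt k * wNorm 1 γ g * wNorm 2 (k + γ / 2) f * wNorm 2 (k + γ / 2) h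
          + A' * wNorm 1 γ f * wNorm 2 (k + γ / 2) g * wNorm 2 (k + γ / 2) h
          + B k * wNorm 2 k f * wNorm 2 k g * wNorm 2 k h) ∧
    (∀ f g : V → ℝ, Measurable f → Measurable g →
      MemWLp 2 (k + γ) f → MemWLp 2 (k + γ) g →
      MemWLp 2 k (Q γ f g) ∧
      wNorm 2 k (Q γ f g) ≤
        A / Real.sqrt k * wNorm 1 γ g * wNorm 2 (k + γ) f
          + A' * wNorm 1 γ f * wNorm 2 (k + γ) g
          + B k * wNorm 2 k f * wNorm 2 k g) := by
  obtain ⟨A, hA, A', hA', B, hB, hmain⟩ := exists_absCollision_bound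
  refine ⟨A, hA, A', hA', B, hB, fun γ k hγ0 hγ hk => ⟨?_, ?_⟩⟩
  · intro f g h hf hg hh hf2 hg2 hh2
    have hf2 := hf2.wl2_ne_top
    have hg2 := hg2.wl2_ne_top
    have hh2 := hh2.wl2_ne_top
    have hf1 := wl1_ne_top (l := γ) (by linarith) hk (by linarith) hf hf2
    have hg1 := wl1_ne_top (l := γ) (by linarith) hk (by linarith) hg hg2
    have hfk := ne_top_of_le_ne_top hf2 (wl2_mono (by linarith : k ≤ k + γ / 2) _)
    have hgk := ne_top_of_le_ne_top hg2 (wl2_mono (by linarith : k ≤ k + γ / 2) _)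
    have hhk := ne_top_of_le_ne_top hh2 (wl2_mono (by linarith : k ≤ k + γ / 2) _)
    have hb := hmain γ (γ / 2) k (by linarith) (by linarith) hγ hk _ _
      (fun v => jw k v * ‖h v‖ₑ) hf.enorm hg.enorm ((measurable_jw k).mul hh.enorm)
    have e : k + γ - γ / 2 = k + γ / 2 := by ring
    have e' : (l2 fun v => jw k v * ‖h v‖ₑ) = wl2 k fun v => ‖h v‖ₑ := rfl
    rw [e, wl2_jw_mul, e', ← ofReal_wNorm_one hf1, ← ofReal_wNorm_one hg1, ← ofReal_wNorm_two hf2,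
      ← ofReal_wNorm_two hg2, ← ofReal_wNorm_two hh2, ← ofReal_wNorm_two hfk,
      ← ofReal_wNorm_two hgk, ← ofReal_wNorm_two hhk] at hb
    have n1 := wNorm_nonneg 1 γ f
    have n2 := wNorm_nonneg 1 γ g
    have n3 := wNorm_nonneg 2 (k + γ / 2) f
    have n4 := wNorm_nonneg 2 (k + γ / 2) g
    have n5 := wNorm_nonneg 2 (k + γ / 2) h
    have n6 := wNorm_nonneg 2 k f
    have n7 := wNorm_nonneg 2 k g
    have n8 := wNorm_nonneg 2 k h
    have hBk := hB k
    simp (disch := positivity) only [← ENNReal.ofReal_mul, ← ENNReal.ofReal_add] at hb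
    have hpt : ∀ v, ‖Q γ f g v * (h v * jap v ^ (2 * k))‖ₑ ≤
        absCollision γ (fun w => ‖f w‖ₑ) (fun w => ‖g w‖ₑ) v *
          (jw k v * (jw k v * ‖h v‖ₑ)) := by
      intro v
      have e2 : ‖jap v ^ (2 * k)‖ₑ = jw k v * jw k v := by
        rw [Real.enorm_of_nonneg (Real.rpow_nonneg (jap_pos v).le _), ← jw_add, two_mul]
        rfl
      rw [enorm_mul, enorm_mul, e2]
      calc _ ≤ absCollision γ (fun w => ‖f w‖ₑ) (fun w => ‖g w‖ₑ) v *
            (‖h v‖ₑ * (jw k v * jw k v)) := by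
            gcongr
            exact enorm_Q_le γ f g v
        _ = _ := by ring
    have hle := (lintegral_mono hpt).trans hb
    have hQm : Measurable (Q γ f g) := (stronglyMeasurable_Q γ hf hg).measurable
    refine ⟨⟨Measurable.aestronglyMeasurable (by fun_prop),
      hle.trans_lt ENNReal.ofReal_lt_top⟩, ?_⟩
    have h3 := (enorm_integral_le_lintegral_enorm _).trans hle
    rw [← ofReal_norm, ENNReal.ofReal_le_ofReal_iff (by positivity)] at h3
    refine (Real.le_norm_self _).trans (h3.trans_eq ?_)
    ring
  · intro f g hf hg hf2 hg2
    have hf2 := hf2.wl2_ne_top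
    have hg2 := hg2.wl2_ne_top
    have hf1 := wl1_ne_top (l := γ) (by linarith) hk (by linarith) hf hf2
    have hg1 := wl1_ne_top (l := γ) (by linarith) hk (by linarith) hg hg2
    have hfk := ne_top_of_le_ne_top hf2 (wl2_mono (by linarith : k ≤ k + γ) _)
    have hgk := ne_top_of_le_ne_top hg2 (wl2_mono (by linarith : k ≤ k + γ) _)
    have n1 := wNorm_nonneg 1 γ f
    have n2 := wNorm_nonneg 1 γ g
    have n3 := wNorm_nonneg 2 (k + γ) f
    have n4 := wNorm_nonneg 2 (k + γ) g
    have n6 := wNorm_nonneg 2 k f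
    have n7 := wNorm_nonneg 2 k g
    have hBk := hB k
    have hm := measurable_absCollision γ hf.enorm hg.enorm
    have hdual : wl2 k (absCollision γ (fun w => ‖f w‖ₑ) (fun w => ‖g w‖ₑ)) ≤
        ENNReal.ofReal (A / Real.sqrt k * wNorm 1 γ g * wNorm 2 (k + γ) f
          + A' * wNorm 1 γ f * wNorm 2 (k + γ) g
          + B k * wNorm 2 k f * wNorm 2 k g) := by
      refine l2_le_of_forall_lintegral_mul_le (by fun_prop) fun H hH => ?_
      have hb := hmain γ 0 k le_rfl hγ0 hγ hk _ _ H hf.enorm hg.enorm hH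
      rw [sub_zero, wl2_zero, ← ofReal_wNorm_one hf1, ← ofReal_wNorm_one hg1,
        ← ofReal_wNorm_two hf2, ← ofReal_wNorm_two hg2, ← ofReal_wNorm_two hfk,
        ← ofReal_wNorm_two hgk] at hb
      refine le_trans (le_of_eq (lintegral_congr fun v => ?_)) (hb.trans_eq ?_)
      · ring
      · simp (disch := positivity) only [ENNReal.ofReal_mul, ENNReal.ofReal_add]
        ring
    have hQm : Measurable (Q γ f g) := (stronglyMeasurable_Q γ hf hg).measurable
    have hle := (l2_mono fun v => mul_le_mul_right (enorm_Q_le γ f g v) (jw k v)).trans hdual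
    change wl2 k (fun v => ‖Q γ f g v‖ₑ) ≤ _ at hle
    rw [wl2_enorm] at hle
    refine ⟨⟨Measurable.aestronglyMeasurable (by fun_prop),
      hle.trans_lt ENNReal.ofReal_lt_top⟩, ?_⟩
    exact ENNReal.toReal_le_of_le_ofReal (by positivity) hle

end Boltzmann

end

theorem mainTheorem3 :
    ∃ C₁ : ℝ, 0 < C₁ ∧ ∃ C₂ : ℝ, 0 < C₂ ∧ ∃ C : ℝ → ℝ, (∀ k : ℝ, 0 < C k) ∧
      ∀ γ k : ℝ, 0 ≤ γ → γ ≤ 1 → 8 ≤ k →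
        -- part (1)
        (∀ f g h : Boltzmann.V → ℝ,
          Boltzmann.MemWLp 2 (k + γ / 2) f →
          Boltzmann.MemWLp 2 (k + γ / 2) g →
          Boltzmann.MemWLp 2 (k + γ / 2) h →
          -- the integral defining `Q(f,g)(v)` converges absolutely for a.e. `v`
          (∀ᵐ v : Boltzmann.V, MeasureTheory.Integrable
            (fun p : Boltzmann.V × Boltzmann.S2 =>
              Boltzmann.collisionIntegrand γ f g v p.1 p.2)
            (MeasureTheory.volume.prod Boltzmann.sphereMeasure)) ∧
          -- and so does the pairing of `Q(f,g)` with `h⟨v⟩^{2k}`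
          MeasureTheory.Integrable
            (fun v : Boltzmann.V =>
              Boltzmann.Q γ f g v * (h v * Boltzmann.jap v ^ (2 * k))) ∧
          Boltzmann.pairing (Boltzmann.Q γ f g) (fun v => h v * Boltzmann.jap v ^ (2 * k)) ≤
            C₁ / Real.sqrt k * Boltzmann.wNorm 1 γ g * Boltzmann.wNorm 2 (k + γ / 2) f
                * Boltzmann.wNorm 2 (k + γ / 2) h
              + C₂ * Boltzmann.wNorm 1 γ f * Boltzmann.wNorm 2 (k + γ / 2) g
                * Boltzmann.wNorm 2 (k + γ / 2) h
              + C k * Boltzmann.wNorm 2 k f * Boltzmann.wNorm 2 k g * Boltzmann.wNorm 2 k h) ∧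
        -- part (2)
        (∀ f g : Boltzmann.V → ℝ,
          Boltzmann.MemWLp 2 (k + γ) f →
          Boltzmann.MemWLp 2 (k + γ) g →
          Boltzmann.MemWLp 2 k (Boltzmann.Q γ f g) ∧
          Boltzmann.wNorm 2 k (Boltzmann.Q γ f g) ≤
            C₁ / Real.sqrt k * Boltzmann.wNorm 1 γ g * Boltzmann.wNorm 2 (k + γ) f
              + C₂ * Boltzmann.wNorm 1 γ f * Boltzmann.wNorm 2 (k + γ) g
              + C k * Boltzmann.wNorm 2 k f * Boltzmann.wNorm 2 k g) := by
  obtain ⟨A, hA, A', hA', B, hB, hmain⟩ := Boltzmann.exists_weighted_pairing_bound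
  refine ⟨A, hA, A', hA', B, hB, fun γ k hγ0 hγ hk => ⟨?_, ?_⟩⟩
  · intro f g h hf hg hh
    obtain ⟨f', hfm, hff⟩ := hf.exists_measurable
    obtain ⟨g', hgm, hgg⟩ := hg.exists_measurable
    obtain ⟨h', hhm, hhh⟩ := hh.exists_measurable
    rw [Boltzmann.memWLp_congr_ae hff] at hf
    rw [Boltzmann.memWLp_congr_ae hgg] at hg
    rw [Boltzmann.memWLp_congr_ae hhh] at hh
    have hprod : (fun v => Boltzmann.Q γ f g v * (h v * Boltzmann.jap v ^ (2 * k))) =ᵐ[volume]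
        fun v => Boltzmann.Q γ f' g' v * (h' v * Boltzmann.jap v ^ (2 * k)) := by
      filter_upwards [Boltzmann.Q_congr_ae γ hff hgg, hhh] with v h1 h2
      rw [h1, h2]
    obtain ⟨hint, hpair⟩ := (hmain γ k hγ0 hγ hk).1 f' g' h' hfm hgm hhm hf hg hh
    refine ⟨?_, hint.congr hprod.symm, ?_⟩
    · filter_upwards [Boltzmann.ae_collisionIntegrand_congr γ hff hgg,
        Boltzmann.absCollision_ae_lt_top hγ0 hγ hk hfm hgm hf.wl2_ne_top hg.wl2_ne_top]
        with v h1 h2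
      exact (Boltzmann.integrable_collisionIntegrand γ hfm hgm h2).congr h1.symm
    · simp only [Boltzmann.wNorm_congr_ae hff, Boltzmann.wNorm_congr_ae hgg,
        Boltzmann.wNorm_congr_ae hhh]
      exact (integral_congr_ae hprod).trans_le hpair
  · intro f g hf hg
    obtain ⟨f', hfm, hff⟩ := hf.exists_measurable
    obtain ⟨g', hgm, hgg⟩ := hg.exists_measurable
    rw [Boltzmann.memWLp_congr_ae hff] at hf
    rw [Boltzmann.memWLp_congr_ae hgg] at hg
    have hQ := Boltzmann.Q_congr_ae γ hff hgg
    rw [Boltzmann.memWLp_congr_ae hQ]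
    simp only [Boltzmann.wNorm_congr_ae hff, Boltzmann.wNorm_congr_ae hgg,
      Boltzmann.wNorm_congr_ae hQ]
    exact (hmain γ k hγ0 hγ hk).2 f' g' hfm hgm hf hg
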